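/- Let $M$ be a connected smooth manifold (Hausdorff, second countable, without boundary) of dimension $n\ge 3$, let $1<k<n$, and let $(\gamma,\sigma)$ be a magnetic system on $M$, i.e. a smooth Riemannian metric $\gamma$ and a smooth closed $2$-form $\sigma$. Let $\mathrm{Y}$ be its Lorentz force operator, $\gamma_x(\mathrm{Y}_x v,w)=\sigma_x(v,w)$ for $v,w\in T_xM$, and call a curve $x$ in $M$ a magnetic geodesic if $\frac{\mathrm{D}\dot x}{\mathrm{d}t}=\mathrm{Y}_{x}(\dot x)$, where $\mathrm{D}/\mathrm{d}t$ is induced by the Levi-Civita connection of $\gamma$. For $s>0$, an immersed submanifold $\iota\colon N\to M$ is totally $s$-magnetic if every magnetic geodesic of speed $s$ which starts tangent to $N$ remains in $N$ for small time: whenever $p\in N$, $w\in T_pN$, and $x$ is a magnetic geodesic with $x(0)=\iota(p)$, $\dot x(0)=\mathrm{d}\iota_p(w)$ and $\gamma(\dot x(0),\dot x(0))=s^2$, there are $\varepsilon>0$ and a continuous curve $c\colon[0,\varepsilon)\to N$ with $c(0)=p$ and $x(t)=\iota(c(t))$ for $0\le t<\varepsilon$. Suppose that for some $s>0$ every $k$-plane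 tangent to $M$ is realized as the tangent space of a $k$-dimensional totally $s$-magnetic immersed submanifold: for all $x\in M$ and all $k$-dimensional subspaces $W\subseteq T_xM$ there are a totally $s$-magnetic immersion $\iota\colon N\to M$ of a $k$-dimensional smooth manifold $N$ and a point $p\in N$ with $\iota(p)=x$ and $\mathrm{d}\iota_p(T_pN)=W$. Then $\sigma=0$ and $\gamma$ has constant sectional curvature, i.e. there is one constant $\kappa\in\mathbb{R}$ such that every tangent $2$-plane at every point of $M$ has sectional curvature $\kappa$. -/

import Mathlib

open Bundle Manifold Set
open scoped Manifold ContDiff Bundle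

noncomputable section

/-! Magnetic systems on a smooth manifold `M` without boundary, modelled on `ℝⁿ`. -/

section Magnetic

variable (n : ℕ) (M : Type*) [TopologicalSpace M] [ChartedSpace (EuclideanSpace ℝ (Fin n)) M]

/-- A field of (continuous) bilinear forms on the tangent spaces of `M`. -/
abbrev BilinField : Type _ :=
  ∀ x : M, TangentSpace (𝓡 n) x →L[ℝ] TangentSpace (𝓡 n) x →L[ℝ] ℝ

variable {n M}

/-- The coordinate expression of a field of bilinear forms in the chart `φ` at `x₀`: the
pullback under `φ⁻¹`, a bilinear form on `ℝⁿ` at every point `y` of the target of `φ`. -/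
def BilinField.inChart (b : BilinField n M) (x₀ : M) (y : EuclideanSpace ℝ (Fin n)) :
    EuclideanSpace ℝ (Fin n) →L[ℝ] EuclideanSpace ℝ (Fin n) →L[ℝ] ℝ :=
  letI A : EuclideanSpace ℝ (Fin n) →L[ℝ] TangentSpace (𝓡 n) ((extChartAt (𝓡 n) x₀).symm y) :=
    mfderiv 𝓘(ℝ, EuclideanSpace ℝ (Fin n)) (𝓡 n) (extChartAt (𝓡 n) x₀).symm y
  (ContinuousLinearMap.precomp ℝ A).comp ((b ((extChartAt (𝓡 n) x₀).symm y)).comp A)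

variable (n M)

/-- A magnetic system `(γ, σ)` on `M`: a smooth Riemannian metric and a smooth closed `2`-form. -/
structure MagneticSystem [IsManifold (𝓡 n) ∞ M] where
  /-- The Riemannian metric `γ`. -/
  metric : ContMDiffRiemannianMetric (𝓡 n) ∞ (EuclideanSpace ℝ (Fin n))
    (fun x : M ↦ TangentSpace (𝓡 n) x)
  /-- The magnetic `2`-form `σ`. -/
  form : BilinField n M
  form_self (x : M) (v : TangentSpace (𝓡 n) x) : form x v v = 0
  form_smooth : ContMDiff (𝓡 n)
    ((𝓡 n).prod 𝓘(ℝ, EuclideanSpace ℝ (Fin n) →L[ℝ] EuclideanSpace ℝ (Fin n) →L[ℝ] ℝ)) ∞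
    (fun x ↦ TotalSpace.mk'
      (EuclideanSpace ℝ (Fin n) →L[ℝ] EuclideanSpace ℝ (Fin n) →L[ℝ] ℝ) x (form x))
  /-- `dσ = 0`, in the coordinates of every chart. -/
  form_closed (x₀ : M) (y : EuclideanSpace ℝ (Fin n)) (hy : y ∈ (extChartAt (𝓡 n) x₀).target)
    (u v w : EuclideanSpace ℝ (Fin n)) :
    fderiv ℝ (form.inChart x₀) y u v w + fderiv ℝ (form.inChart x₀) y v w u
      + fderiv ℝ (form.inChart x₀) y w u v = 0

variable {n M}

/-- The Christoffel symbol `Γ_y(u, v)` of the Levi-Civita connection of `g` in the chart at `x₀`.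
With `G` the coordinate expression of `g`, it is the vector such that, for all `w`,
`G_y(Γ_y(u, v), w) = (D_u G(v, w) + D_v G(u, w) - D_w G(u, v)) / 2`. -/
def christoffel (g : BilinField n M) (x₀ : M) (y u v : EuclideanSpace ℝ (Fin n)) :
    EuclideanSpace ℝ (Fin n) :=
  (g.inChart x₀ y).inverse
    ((1 / 2 : ℝ) • (fderiv ℝ (g.inChart x₀) y u v + fderiv ℝ (g.inChart x₀) y v u
      - ((fderiv ℝ (g.inChart x₀) y).flip u).flip v))

/-- The curvature `R_y(u, v) w = ∇_u ∇_v w - ∇_v ∇_u w` of `g` in the chart at `x₀`, where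
`u`, `v`, `w` stand for constant coordinate vector fields. -/
def curvatureInChart (g : BilinField n M) (x₀ : M) (y u v w : EuclideanSpace ℝ (Fin n)) :
    EuclideanSpace ℝ (Fin n) :=
  fderiv ℝ (fun z ↦ christoffel g x₀ z v w) y u - fderiv ℝ (fun z ↦ christoffel g x₀ z u w) y v
    + christoffel g x₀ y u (christoffel g x₀ y v w)
    - christoffel g x₀ y v (christoffel g x₀ y u w)

/-- The sectional curvature of the plane spanned by `u, v ∈ T_x M`:
`g(R(u, v) v, u) / (g(u, u) g(v, v) - g(u, v)²)`, computed in the chart at `x`. -/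
def sectionalCurvature (g : BilinField n M) (x : M) (u v : TangentSpace (𝓡 n) x) : ℝ :=
  letI A : TangentSpace (𝓡 n) x →L[ℝ] EuclideanSpace ℝ (Fin n) :=
    mfderiv (𝓡 n) 𝓘(ℝ, EuclideanSpace ℝ (Fin n)) (extChartAt (𝓡 n) x) x
  letI y := extChartAt (𝓡 n) x x
  g.inChart x y (curvatureInChart g x y (A u) (A v) (A v)) (A u)
    / (g x u u * g x v v - (g x u v) ^ 2)

/-- All tangent planes at all points have the same sectional curvature. -/
def HasConstantSectionalCurvature (g : BilinField n M) : Prop :=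
  ∃ κ : ℝ, ∀ (x : M) (u v : TangentSpace (𝓡 n) x),
    LinearIndependent ℝ ![u, v] → sectionalCurvature g x u v = κ

variable [IsManifold (𝓡 n) ∞ M]

/-- The Lorentz force operator `Y_x : T_x M → T_x M`, given by `γ_x(Y_x v, w) = σ_x(v, w)`. -/
def MagneticSystem.lorentzForce (S : MagneticSystem n M) (x : M) (v : TangentSpace (𝓡 n) x) :
    TangentSpace (𝓡 n) x :=
  (S.metric.inner x).inverse (S.form x v)

/-- The velocity vector `ẋ(t) ∈ T_{x(t)} M` of a curve. -/
def curveVelocity (x : ℝ → M) (t : ℝ) : TangentSpace (𝓡 n) (x t) :=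
  mfderiv 𝓘(ℝ, ℝ) (𝓡 n) x t (1 : ℝ)

/-- `x` solves the magnetic geodesic equation `Dẋ/dt = Y(ẋ)` on the open set `J` of times.
In a chart `φ`, with `c = φ ∘ x`, the equation reads `c'' + Γ(c', c') = dφ(Y(ẋ))`; both sides
transform as tangent vectors, so it does not matter in which chart around `x(t)` it is written. -/
def MagneticSystem.IsMagneticGeodesicOn (S : MagneticSystem n M) (x : ℝ → M) (J : Set ℝ) :
    Prop :=
  ContMDiffOn 𝓘(ℝ, ℝ) (𝓡 n) 2 x J ∧
  ∀ t ∈ J, ∃ x₀ : M, x t ∈ (extChartAt (𝓡 n) x₀).source ∧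
    letI c : ℝ → EuclideanSpace ℝ (Fin n) := fun τ ↦ extChartAt (𝓡 n) x₀ (x τ)
    deriv (deriv c) t + christoffel S.metric.inner x₀ (c t) (deriv c t) (deriv c t) =
      mfderiv (𝓡 n) 𝓘(ℝ, EuclideanSpace ℝ (Fin n)) (extChartAt (𝓡 n) x₀) (x t)
        (S.lorentzForce (x t) (curveVelocity x t))

/-- The immersion `ι : N → M` is totally `s`-magnetic: every solution `x` of the magnetic geodesic
equation with speed `s` which starts tangent to `N`, i.e. with `x(0) = ι(p)` and
`ẋ(0) = dι_p(w)`, remains in `N` for small time. As `N` carries its own topology, the latter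
means that `x` is, for small time, the image of a continuous curve in `N` starting at `p`. -/
def MagneticSystem.IsTotallyMagnetic (S : MagneticSystem n M) (s : ℝ) {k : ℕ} {N : Type*}
    [TopologicalSpace N] [ChartedSpace (EuclideanSpace ℝ (Fin k)) N] (ι : N → M) : Prop :=
  ∀ (p : N) (w : TangentSpace (𝓡 k) p) (x : ℝ → M) (δ : ℝ), 0 < δ →
    S.IsMagneticGeodesicOn x (Ioo (-δ) δ) →
    (⟨x 0, curveVelocity x 0⟩ : TangentBundle (𝓡 n) M) = tangentMap (𝓡 k) (𝓡 n) ι ⟨p, w⟩ →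
    S.metric.inner (x 0) (curveVelocity x 0) (curveVelocity x 0) = s ^ 2 →
    ∃ ε > 0, ∃ c : ℝ → N, ContinuousOn c (Ico 0 ε) ∧ c 0 = p ∧ ∀ t ∈ Ico 0 ε, ι (c t) = x t

/-- The subspace `W ⊆ T_x M` is the tangent space at `x` of a `k`-dimensional immersed submanifold
`ι : N → M` which is totally `s`-magnetic. (Every second countable Hausdorff manifold is
diffeomorphic to one whose underlying type lives in `Type`.) -/
def MagneticSystem.IsTangentToTotallyMagnetic (S : MagneticSystem n M) (s : ℝ) (k : ℕ) (x : M)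
    (W : Submodule ℝ (TangentSpace (𝓡 n) x)) : Prop :=
  ∃ (N : Type) (_ : TopologicalSpace N) (_ : ChartedSpace (EuclideanSpace ℝ (Fin k)) N)
    (_ : IsManifold (𝓡 k) ∞ N) (_ : T2Space N) (_ : SecondCountableTopology N)
    (ι : N → M) (p : N),
    IsImmersion (𝓡 k) (𝓡 n) ∞ ι ∧ ι p = x ∧
    (∀ v : TangentSpace (𝓡 n) x, v ∈ W ↔ ∃ w : TangentSpace (𝓡 k) p,
      tangentMap (𝓡 k) (𝓡 n) ι ⟨p, w⟩ = (⟨x, v⟩ : TangentBundle (𝓡 n) M)) ∧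
    S.IsTotallyMagnetic (k := k) s ι

end Magnetic

end

/-!
The argument is local. In a chart of `M`, let `G` be the metric, `Γ` its Christoffel symbols and `Y`
the Lorentz force. An immersed submanifold is locally the slice `{Φ₂ = 0}` of a coordinate system
`Φ = (Φ₁, Φ₂)` of the chart, parametrized by a map `f` with `Φ ∘ f = (id, 0)` (`exists_isSlice`).

If the submanifold is totally `s`-magnetic, then for each tangent vector `w` of speed `s` the
solution `c` of `c'' = Y c' - Γ(c', c')` with `c'(0) = w` stays in `{Φ₂ = 0}` for small positive
times, so that the second derivative of `Φ₂ ∘ c` at `0` vanishes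
(`MagneticSystem.IsTotallyMagnetic.second_order`):
`D²Φ₂(w, w) + DΦ₂(Y w - Γ(w, w)) = 0`.
The vector `-w` satisfies the same equation, and the odd and even parts under `w ↦ -w` separate
(`IsSlice.fderiv_snd_eq_zero_and`). The odd part `DΦ₂(Y w) = 0` says that `Y` preserves the tangent
spaces of the submanifold. The even part `D²Φ₂(w, w) = DΦ₂(Γ(w, w))` says that the submanifold is
totally geodesic: the connection of `M` restricts to a connection of the submanifold, and as
curvature is natural under maps which intertwine connections (`fderiv_connCurvature`), the tangent
spaces are invariant under the curvature tensor `R`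
(`IsSlice.exists_fderiv_eq_connCurvature`).

By hypothesis all `k`-planes are such tangent spaces. Each subspace of dimension at most `k < n` is
the intersection of the `k`-planes which contain it (`mem_of_forall_finrank_eq`). Hence `Y` maps
each line to itself, and being skew-symmetric it vanishes (`eq_zero_of_forall_mem_of_skew`).
Likewise, as `k ≥ 2`, the vector `R(u, v)v` lies in the plane of `u` and `v`, and by the symmetries
of the curvature tensor `R(u, v)w = κ (G(v, w)u - G(u, w)v)` with a number `κ` at each point
(`exists_eq_smul_of_forall_mem`). By Schur's lemma the derivative of `κ` vanishes
(`IsMetricOn.fderiv_eq_zero_of_connCurvature_eq`), `κ` does not depend on the chart, as the change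
of charts intertwines the connections (`fderiv_leviCivita`), and `M` is connected; so `κ` is
constant.
-/

open Filter Topology

set_option maxSynthPendingDepth 5
set_option synthInstance.maxHeartbeats 100000

/-! ### Linear algebra of invariant planes -/

section LinearAlgebra

variable {E : Type*} [NormedAddCommGroup E] [NormedSpace ℝ E]

theorem exists_notMem_of_finrank_lt {P : Submodule ℝ E}
    (h : Module.finrank ℝ P < Module.finrank ℝ E) : ∃ w, w ∉ P := by
  by_contra! hP
  have : P = ⊤ := by ext; simp [hP]
  rw [this, finrank_top] at h
  exact lt_irrefl _ h

theorem finrank_span_singleton_le_one (v : E) : Module.finrank ℝ ↥(ℝ ∙ v) ≤ 1 := by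
  simpa using finrank_span_le_card (R := ℝ) ({v} : Set E)

theorem finrank_span_pair_le (u v : E) : Module.finrank ℝ ↥(Submodule.span ℝ {u, v}) ≤ 2 := by
  classical
  have h := finrank_span_finset_le_card (R := ℝ) ({u, v} : Finset E)
  rw [Set.finrank] at h
  have h2 : (({u, v} : Finset E) : Set E) = {u, v} := by simp
  rw [h2] at h
  exact h.trans Finset.card_le_two

/-- The Gram determinant of two linearly independent vectors does not vanish. -/
theorem gram_ne_zero {g : E →L[ℝ] E →L[ℝ] ℝ} (hsymm : ∀ u v, g u v = g v u)
    (hpos : ∀ v, v ≠ 0 → 0 < g v v) {u v : E} (h : LinearIndependent ℝ ![u, v]) :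
    g u u * g v v - g u v ^ 2 ≠ 0 := by
  have hv : v ≠ 0 := h.ne_zero 1
  have hz : g v v • u - g u v • v ≠ 0 := by
    intro h0
    have := LinearIndependent.pair_iff.1 h (g v v) (-g u v)
      (by rw [neg_smul]; simpa [sub_eq_add_neg] using h0)
    exact (hpos v hv).ne' this.1
  have hp := hpos _ hz
  -- The component of `u` orthogonal to `v`, scaled by `g v v`, has positive square.
  have hexp : g (g v v • u - g u v • v) (g v v • u - g u v • v)
      = g v v * (g u u * g v v - g u v ^ 2) := by
    simp only [map_sub, map_smul, sub_apply, smul_apply, smul_eq_mul, hsymm v u]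
    ring
  rw [hexp] at hp
  intro h0
  rw [h0, mul_zero] at hp
  exact lt_irrefl _ hp

theorem linearIndependent_pair_of_notMem_span {u v : E} (hv : v ≠ 0) (hu : u ∉ ℝ ∙ v) :
    LinearIndependent ℝ ![u, v] := by
  rw [LinearIndependent.pair_iff]
  intro s t hst
  rcases eq_or_ne s 0 with rfl | hs
  · refine ⟨rfl, ?_⟩
    simpa [hv] using hst
  · refine absurd (Submodule.mem_span_singleton.2 ⟨-(s⁻¹ * t), ?_⟩) hu
    have : s • u = -(t • v) := eq_neg_of_add_eq_zero_left hst
    rw [neg_smul, mul_smul, ← smul_neg, ← this, smul_smul, inv_mul_cancel₀ hs, one_smul]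

variable [FiniteDimensional ℝ E]

theorem finrank_sup_span_singleton_le (P : Submodule ℝ E) (z : E) :
    Module.finrank ℝ ↥(P ⊔ ℝ ∙ z) ≤ Module.finrank ℝ P + 1 :=
  (Submodule.finrank_add_le_finrank_add_finrank _ _).trans
    (Nat.add_le_add_left (finrank_span_singleton_le_one z) _)

/-- A subspace of dimension at most `k` which does not contain `z` extends to a `k`-plane which does
not contain `z`. -/
theorem exists_submodule_finrank_eq_of_notMem {k : ℕ} (hk : k < Module.finrank ℝ E)
    (P : Submodule ℝ E) (hP : Module.finrank ℝ P ≤ k) {z : E} (hz : z ∉ P) :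
    ∃ W : Submodule ℝ E, P ≤ W ∧ Module.finrank ℝ W = k ∧ z ∉ W := by
  induction hd : k - Module.finrank ℝ P generalizing P with
  | zero => exact ⟨P, le_rfl, by omega, hz⟩
  | succ d ih =>
    have hlt : Module.finrank ℝ ↥(P ⊔ ℝ ∙ z) < Module.finrank ℝ E := by
      have := finrank_sup_span_singleton_le P z
      omega
    obtain ⟨w, hw⟩ := exists_notMem_of_finrank_lt hlt
    have hzP : z ∉ P ⊔ ℝ ∙ w := by
      intro hmem
      obtain ⟨p, hp, q, hq, hpq⟩ := Submodule.mem_sup.1 hmem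
      obtain ⟨c, rfl⟩ := Submodule.mem_span_singleton.1 hq
      rcases eq_or_ne c 0 with rfl | hc
      · exact hz (by simpa [← hpq] using hp)
      · refine hw ?_
        have : w = c⁻¹ • (z - p) := by
          rw [← hpq, add_sub_cancel_left, smul_smul, inv_mul_cancel₀ hc, one_smul]
        rw [this]
        exact Submodule.smul_mem _ _ (Submodule.sub_mem _
          (Submodule.mem_sup_right (Submodule.mem_span_singleton_self z))
          (Submodule.mem_sup_left hp))
    have hgt : Module.finrank ℝ P < Module.finrank ℝ ↥(P ⊔ ℝ ∙ w) := by
      refine Submodule.finrank_lt_finrank_of_lt (lt_of_le_of_ne le_sup_left fun h ↦ hw ?_)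
      have hwP : w ∈ P := h ▸ Submodule.mem_sup_right (Submodule.mem_span_singleton_self w)
      exact Submodule.mem_sup_left hwP
    have hle := finrank_sup_span_singleton_le P w
    obtain ⟨W, hW, hWk, hzW⟩ := ih (P ⊔ ℝ ∙ w) (by omega) hzP (by omega)
    exact ⟨W, le_sup_left.trans hW, hWk, hzW⟩

/-- A subspace of dimension at most `k < dim E` is the intersection of the `k`-planes which
contain it. -/
theorem mem_of_forall_finrank_eq {k : ℕ} (hk : k < Module.finrank ℝ E) {P : Submodule ℝ E}
    (hP : Module.finrank ℝ P ≤ k) {z : E}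
    (h : ∀ W : Submodule ℝ E, P ≤ W → Module.finrank ℝ W = k → z ∈ W) : z ∈ P := by
  by_contra hz
  obtain ⟨W, hPW, hW, hzW⟩ := exists_submodule_finrank_eq_of_notMem hk P hP hz
  exact hzW (h W hPW hW)

/-- An operator which preserves all `k`-planes is a homothety at each vector; if it is also
skew-symmetric for a positive definite form, it vanishes. -/
theorem eq_zero_of_forall_mem_of_skew {k : ℕ} (hk0 : 1 ≤ k) (hk : k < Module.finrank ℝ E)
    (g : E →L[ℝ] E →L[ℝ] ℝ) (hpos : ∀ v, v ≠ 0 → 0 < g v v) (Z : E → E)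
    (hZ : ∀ v, g (Z v) v = 0)
    (hW : ∀ W : Submodule ℝ E, Module.finrank ℝ W = k → ∀ v ∈ W, Z v ∈ W) (v : E) : Z v = 0 := by
  have hmem : Z v ∈ ℝ ∙ v := mem_of_forall_finrank_eq hk
    ((finrank_span_singleton_le_one v).trans hk0)
    fun W hvW hWk ↦ hW W hWk v ((Submodule.span_singleton_le_iff_mem v W).1 hvW)
  obtain ⟨c, hc⟩ := Submodule.mem_span_singleton.1 hmem
  rcases eq_or_ne v 0 with rfl | hv
  · rw [← hc, smul_zero]
  · have h := hZ v
    rw [← hc, map_smul, smul_apply, smul_eq_mul] at h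
    rw [← hc, (mul_eq_zero.1 h).resolve_right (hpos v hv).ne', zero_smul]

/-- If `R(u, v)v` always lies in the plane of `u` and `v`, then for fixed `v` the endomorphism
`u ↦ R(u, v)v` induces on `E / ⟨v⟩` is a homothety, as each vector is an eigenvector. -/
theorem exists_apply_self_eq_smul {g : E →L[ℝ] E →L[ℝ] ℝ}
    (hpos : ∀ v, v ≠ 0 → 0 < g v v) {R : E →L[ℝ] E →L[ℝ] E →L[ℝ] E}
    (hskew : ∀ u v w, R u v w = -R v u w) (hg : ∀ u v w, g (R u v w) w = 0)
    (hspan : ∀ u v, R u v v ∈ Submodule.span ℝ {u, v}) {v : E} (hv : v ≠ 0) :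
    ∃ μ : ℝ, ∀ u, R u v v = μ • (g v v • u - g u v • v) := by
  have hRvv : R v v = 0 := by
    ext w
    have h : (2 : ℝ) • R v v w = 0 := by
      nth_rewrite 1 [two_smul, hskew v v w]
      exact neg_add_cancel _
    simpa using h
  let T : E →ₗ[ℝ] E := ((R.flip v).flip v : E →L[ℝ] E)
  have hT : ∀ u, T u = R u v v := fun u ↦ rfl
  let S : (E ⧸ (ℝ ∙ v)) →ₗ[ℝ] (E ⧸ (ℝ ∙ v)) := (ℝ ∙ v).mapQ (ℝ ∙ v) T (by
    rw [Submodule.span_singleton_le_iff_mem, Submodule.mem_comap, hT, hRvv]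
    simp)
  obtain ⟨a, ha⟩ : ∃ a : ℝ, S = a • 1 := by
    refine LinearMap.exists_eq_smul_id_of_forall_notLinearIndependent fun q ↦ ?_
    obtain ⟨u, rfl⟩ := Submodule.mkQ_surjective _ q
    rw [LinearIndependent.pair_iff]
    intro hq
    obtain ⟨c, d, hcd⟩ := Submodule.mem_span_pair.1 (hspan u v)
    have h := hq c (-1) (by
      have : S ((ℝ ∙ v).mkQ u) = (ℝ ∙ v).mkQ (c • u + d • v) := by
        rw [hcd]; rfl
      rw [this, map_add, map_smul, map_smul]
      have hv0 : (ℝ ∙ v).mkQ v = 0 := by simp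
      rw [hv0]; simp)
    norm_num at h
  refine ⟨a / g v v, fun u ↦ ?_⟩
  have hgv := (hpos v hv).ne'
  have hmem : R u v v - a • u ∈ ℝ ∙ v := by
    have h := LinearMap.congr_fun ha ((ℝ ∙ v).mkQ u)
    have h2 : (ℝ ∙ v).mkQ (R u v v) = (ℝ ∙ v).mkQ (a • u) := by
      rw [map_smul]; exact h
    rwa [Submodule.mkQ_apply, Submodule.mkQ_apply, Submodule.Quotient.eq] at h2
  obtain ⟨b, hb⟩ := Submodule.mem_span_singleton.1 hmem
  have hR : R u v v = a • u + b • v := by rw [hb]; abel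
  have h0 := hg u v v
  rw [hR] at h0
  simp only [map_add, map_smul, add_apply, smul_apply,
    smul_eq_mul] at h0
  have hb' : b = -(a / g v v * g u v) := by
    field_simp
    linarith
  rw [hR, hb', smul_sub, smul_smul, smul_smul, div_mul_cancel₀ _ hgv]
  module

/-- If all `k`-planes are invariant under the curvature-like tensor `R`, then `R` is the curvature
tensor of a space of constant curvature. -/
theorem exists_eq_smul_of_forall_mem {k : ℕ} (hk0 : 2 ≤ k) (hk : k < Module.finrank ℝ E)
    {g : E →L[ℝ] E →L[ℝ] ℝ} (hsymm : ∀ u v, g u v = g v u)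
    (hpos : ∀ v, v ≠ 0 → 0 < g v v) {R : E →L[ℝ] E →L[ℝ] E →L[ℝ] E}
    (hskew : ∀ u v w, R u v w = -R v u w) (hg : ∀ u v w z, g (R u v w) z + g w (R u v z) = 0)
    (hbianchi : ∀ u v w, R u v w + R v w u + R w u v = 0)
    (hW : ∀ W : Submodule ℝ E, Module.finrank ℝ W = k → ∀ u ∈ W, ∀ v ∈ W, ∀ w ∈ W, R u v w ∈ W) :
    ∃ κ : ℝ, ∀ u v w, R u v w = κ • (g v w • u - g u w • v) := by
  have hspan : ∀ u v, R u v v ∈ Submodule.span ℝ {u, v} := fun u v ↦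
    mem_of_forall_finrank_eq hk ((finrank_span_pair_le u v).trans hk0) fun W hP hWk ↦
      have hu : u ∈ W := hP (Submodule.subset_span (by simp))
      have hv : v ∈ W := hP (Submodule.subset_span (by simp))
      hW W hWk u hu v hv v hv
  have hg0 : ∀ u v w, g (R u v w) w = 0 := fun u v w ↦ by
    have h := hg u v w w
    rw [hsymm w] at h
    linarith
  choose! μ hμ using fun v (hv : v ≠ 0) ↦ exists_apply_self_eq_smul hpos hskew hg0 hspan hv
  have hμeq : ∀ u v, LinearIndependent ℝ ![u, v] → μ u = μ v := by
    intro u v huv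
    have hu : u ≠ 0 := huv.ne_zero 0
    have hv : v ≠ 0 := huv.ne_zero 1
    have h1 : g (R u v v) u = μ v * (g u u * g v v - g u v ^ 2) := by
      rw [hμ v hv u]
      simp only [map_sub, map_smul, sub_apply, smul_apply, smul_eq_mul, hsymm v u]
      ring
    have h2 : g (R v u u) v = μ u * (g u u * g v v - g u v ^ 2) := by
      rw [hμ u hu v]
      simp only [map_sub, map_smul, sub_apply, smul_apply, smul_eq_mul, hsymm v u]
      ring
    have h3 : g (R u v v) u = g (R v u u) v := by
      have h := hg u v v u
      have h' : R v u u = (-1 : ℝ) • R u v u := by rw [hskew v u, neg_one_smul]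
      rw [h', map_smul, smul_apply, hsymm (R u v u) v, smul_eq_mul]
      linarith
    have h4 := gram_ne_zero hsymm hpos huv
    exact mul_right_cancel₀ h4 (by rw [← h1, ← h2, h3])
  have hE : 2 < Module.finrank ℝ E := by omega
  -- Any two nonzero vectors `v`, `e` have a common partner `w`, as `dim E ≥ 3`.
  obtain ⟨e, he⟩ := exists_notMem_of_finrank_lt (P := (⊥ : Submodule ℝ E))
    (by rw [finrank_bot]; omega)
  have he0 : e ≠ 0 := fun h ↦ he (by simp [h])
  have hμe : ∀ v, v ≠ 0 → μ v = μ e := by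
    intro v hv
    obtain ⟨w, hw⟩ := exists_notMem_of_finrank_lt ((finrank_span_pair_le v e).trans_lt hE)
    have h1 : w ∉ ℝ ∙ v := fun h ↦ hw (Submodule.span_mono (by simp) h)
    have h2 : w ∉ ℝ ∙ e := fun h ↦ hw (Submodule.span_mono (by simp) h)
    rw [← hμeq w v (linearIndependent_pair_of_notMem_span hv h1),
      hμeq w e (linearIndependent_pair_of_notMem_span he0 h2)]
  refine ⟨μ e, ?_⟩
  -- The difference `T` of both sides is alternating in its first two and in its last two arguments,
  -- hence invariant under cyclic permutations, and the Bianchi identity gives `3 T = 0`.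
  let T : E → E → E → E := fun u v w ↦ R u v w - μ e • (g v w • u - g u w • v)
  have hT0 : ∀ u v, T u v v = 0 := by
    intro u v
    rcases eq_or_ne v 0 with rfl | hv
    · simp [T]
    · simp only [T]; rw [hμ v hv u, hμe v hv, sub_self]
  have hT23 : ∀ u v w, T u v w = -T u w v := by
    intro u v w
    have h := hT0 u (v + w)
    have h1 := hT0 u v
    have h2 := hT0 u w
    simp only [T, map_add, add_apply] at h h1 h2 ⊢
    rw [hsymm w v] at h
    rw [hsymm w v]
    linear_combination (norm := module) h - h1 - h2
  have hT12 : ∀ u v w, T u v w = -T v u w := by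
    intro u v w
    simp only [T]
    rw [hskew u v]
    module
  have hTcyc : ∀ u v w, T u v w + T v w u + T w u v = 0 := by
    intro u v w
    have h := hbianchi u v w
    simp only [T]
    rw [hsymm w u, hsymm v u, hsymm w v]
    linear_combination (norm := module) h
  intro u v w
  have h1 : T v w u = T u v w := by rw [hT23 v w u, hT12 v u w, neg_neg]
  have h2 : T w u v = T u v w := by rw [hT12 w u v, hT23 u w v, neg_neg]
  have h := hTcyc u v w
  rw [h1, h2] at h
  have h3 : (3 : ℝ) • T u v w = 0 := by rw [← h]; module
  have h4 : T u v w = 0 := (smul_eq_zero.1 h3).resolve_left (by norm_num)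
  exact sub_eq_zero.1 h4

end LinearAlgebra

/-! ### Connections and metrics on open sets of a vector space -/

section Connections

variable {E : Type*} [NormedAddCommGroup E] [NormedSpace ℝ E]
  {E' : Type*} [NormedAddCommGroup E'] [NormedSpace ℝ E']
  {F : Type*} [NormedAddCommGroup F] [NormedSpace ℝ F]
  {F' : Type*} [NormedAddCommGroup F'] [NormedSpace ℝ F']

theorem fderiv_clm_apply_apply {A : E → E' →L[ℝ] F} {B : E → E'} {y : E}
    (hA : DifferentiableAt ℝ A y) (hB : DifferentiableAt ℝ B y) (b : E) :
    fderiv ℝ (fun z ↦ A z (B z)) y b = fderiv ℝ A y b (B y) + A y (fderiv ℝ B y b) := by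
  rw [fderiv_clm_apply hA hB]
  simp [add_comm]

theorem fderiv_clm_apply_const {A : E → E' →L[ℝ] F} {y : E} (hA : DifferentiableAt ℝ A y)
    (v : E') (b : E) : fderiv ℝ (fun z ↦ A z v) y b = fderiv ℝ A y b v := by
  rw [fderiv_clm_apply_apply hA (differentiableAt_const v)]
  simp

theorem fderiv_clm_apply₂_const {A : E → E' →L[ℝ] F' →L[ℝ] F} {y : E}
    (hA : DifferentiableAt ℝ A y) (u : E') (v : F') (b : E) :
    fderiv ℝ (fun z ↦ A z u v) y b = fderiv ℝ A y b u v := by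
  have hAu : DifferentiableAt ℝ (fun z ↦ A z u) y := by fun_prop
  rw [fderiv_clm_apply_const hAu, fderiv_clm_apply_const hA]

theorem fderiv_clm_apply₃_const {F'' : Type*} [NormedAddCommGroup F''] [NormedSpace ℝ F'']
    {A : E → E' →L[ℝ] F' →L[ℝ] F'' →L[ℝ] F} {y : E}
    (hA : DifferentiableAt ℝ A y) (u : E') (v : F') (w : F'') (b : E) :
    fderiv ℝ (fun z ↦ A z u v w) y b = fderiv ℝ A y b u v w := by
  have hAu : DifferentiableAt ℝ (fun z ↦ A z u) y := by fun_prop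
  rw [fderiv_clm_apply₂_const hAu, fderiv_clm_apply_const hA]

theorem fderiv_clm_apply₂ {A : E → E' →L[ℝ] F' →L[ℝ] F} {B : E → E'} {C : E → F'} {y : E}
    (hA : DifferentiableAt ℝ A y) (hB : DifferentiableAt ℝ B y) (hC : DifferentiableAt ℝ C y)
    (b : E) : fderiv ℝ (fun z ↦ A z (B z) (C z)) y b
      = fderiv ℝ A y b (B y) (C y) + A y (fderiv ℝ B y b) (C y)
        + A y (B y) (fderiv ℝ C y b) := by
  have hAB : DifferentiableAt ℝ (fun z ↦ A z (B z)) y := by fun_prop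
  rw [fderiv_clm_apply_apply hAB hC, fderiv_clm_apply_apply hA hB, add_apply]

/-- The curvature `R(u, v)w = ∇_u ∇_v w - ∇_v ∇_u w` of the connection `∇ = D + Γ`, for constant
vector fields `u`, `v`, `w`. -/
noncomputable def connCurvature (Γ : E → E →L[ℝ] E →L[ℝ] E) (y : E) :
    E →L[ℝ] E →L[ℝ] E →L[ℝ] E :=
  letI B : E →L[ℝ] E →L[ℝ] E →L[ℝ] E :=
    (ContinuousLinearMap.compL ℝ E E E).bilinearComp (Γ y) (Γ y)
  (fderiv ℝ Γ y - (fderiv ℝ Γ y).flip) + (B - B.flip)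

theorem connCurvature_apply (Γ : E → E →L[ℝ] E →L[ℝ] E) (y u v w : E) :
    connCurvature Γ y u v w = fderiv ℝ Γ y u v w - fderiv ℝ Γ y v u w + Γ y u (Γ y v w)
      - Γ y v (Γ y u w) := by
  simp only [connCurvature, add_apply, sub_apply, ContinuousLinearMap.flip_apply,
    ContinuousLinearMap.bilinearComp_apply, ContinuousLinearMap.compL_apply,
    ContinuousLinearMap.comp_apply]
  abel

/-- Curvature is natural: if `f` intertwines the connections `D + C` and `D + Γ`, then it
intertwines their curvatures. For `f` a change of coordinates this is the tensoriality of the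
curvature, for `f` an immersion it says that the tangent spaces of a totally geodesic submanifold
are invariant under the curvature. -/
theorem fderiv_connCurvature {f : E' → E} {y : E'} {C : E' → E' →L[ℝ] E' →L[ℝ] E'}
    {Γ : E → E →L[ℝ] E →L[ℝ] E} (hf : ContDiffAt ℝ 3 f y) (hΓ : DifferentiableAt ℝ Γ (f y))
    (hC : DifferentiableAt ℝ C y)
    (h : ∀ᶠ z in 𝓝 y, ∀ a c, fderiv ℝ f z (C z a c)
      = fderiv ℝ (fderiv ℝ f) z a c + Γ (f z) (fderiv ℝ f z a) (fderiv ℝ f z c)) (a b c : E') :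
    fderiv ℝ f y (connCurvature C y a b c)
      = connCurvature Γ (f y) (fderiv ℝ f y a) (fderiv ℝ f y b) (fderiv ℝ f y c) := by
  have hA : ContDiffAt ℝ 2 (fderiv ℝ f) y := hf.fderiv_right (by norm_num)
  have hDA : ContDiffAt ℝ 1 (fderiv ℝ (fderiv ℝ f)) y := hA.fderiv_right (by norm_num)
  have hf' : DifferentiableAt ℝ f y := hf.differentiableAt (by norm_num)
  have hA' : DifferentiableAt ℝ (fderiv ℝ f) y := hA.differentiableAt (by norm_num)
  have hDA' : DifferentiableAt ℝ (fderiv ℝ (fderiv ℝ f)) y := hDA.differentiableAt (by norm_num)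
  have hΓf : DifferentiableAt ℝ (fun z ↦ Γ (f z)) y :=
    DifferentiableAt.comp y (g := Γ) hΓ hf'
  -- The derivative of `h` in direction `b`; the third derivative of `f` and all other terms which
  -- do not belong to the curvature are symmetric in `a` and `b`.
  have key : ∀ a b c, fderiv ℝ (fderiv ℝ f) y b (C y a c) + fderiv ℝ f y (fderiv ℝ C y b a c)
      = fderiv ℝ (fderiv ℝ (fderiv ℝ f)) y b a c
        + (fderiv ℝ Γ (f y) (fderiv ℝ f y b) (fderiv ℝ f y a) (fderiv ℝ f y c)
        + Γ (f y) (fderiv ℝ (fderiv ℝ f) y b a) (fderiv ℝ f y c)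
        + Γ (f y) (fderiv ℝ f y a) (fderiv ℝ (fderiv ℝ f) y b c)) := by
    intro a b c
    have e : (fun z ↦ fderiv ℝ f z (C z a c)) =ᶠ[𝓝 y] fun z ↦
        fderiv ℝ (fderiv ℝ f) z a c + Γ (f z) (fderiv ℝ f z a) (fderiv ℝ f z c) := by
      filter_upwards [h] with z hz using hz a c
    have e' := DFunLike.congr_fun (e.fderiv_eq (𝕜 := ℝ)) b
    rw [fderiv_clm_apply_apply hA' (by fun_prop), fderiv_fun_add (by fun_prop) (by fun_prop),
      add_apply, fderiv_clm_apply₂_const hC, fderiv_clm_apply₂_const hDA',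
      fderiv_clm_apply₂ hΓf (by fun_prop) (by fun_prop), fderiv_clm_apply_const hA',
      fderiv_clm_apply_const hA'] at e'
    have hcomp : fderiv ℝ (fun z ↦ Γ (f z)) y b = fderiv ℝ Γ (f y) (fderiv ℝ f y b) := by
      have := fderiv_comp y hΓ hf'
      exact DFunLike.congr_fun this b
    rw [hcomp] at e'
    exact e'
  have hs : ∀ a b, fderiv ℝ (fderiv ℝ f) y a b = fderiv ℝ (fderiv ℝ f) y b a := fun a b ↦
    (hf.isSymmSndFDerivAt (by simp; norm_num)) a b
  have hs2 : ∀ a b, fderiv ℝ (fderiv ℝ (fderiv ℝ f)) y a b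
      = fderiv ℝ (fderiv ℝ (fderiv ℝ f)) y b a := fun a b ↦
    (hA.isSymmSndFDerivAt (by simp)) a b
  have h0 := h.self_of_nhds
  have k1 := key a b c
  have k2 := key b a c
  have j1 := h0 a (C y b c)
  have j2 := h0 b (C y a c)
  rw [h0 b c, map_add] at j1
  rw [h0 a c, map_add] at j2
  rw [hs b a, hs2 b a] at k1
  simp only [connCurvature_apply, map_add, map_sub]
  rw [j1, j2]
  linear_combination (norm := module) k2 - k1

/-- The Koszul expression `(D_u G(v, w) + D_v G(u, w) - D_w G(u, v)) / 2`. -/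
noncomputable def koszul (G : E → E →L[ℝ] E →L[ℝ] ℝ) (y : E) : E →L[ℝ] E →L[ℝ] E →L[ℝ] ℝ :=
  (1 / 2 : ℝ) • (fderiv ℝ G y + (fderiv ℝ G y).flip
    - ((ContinuousLinearMap.flipₗᵢ ℝ E E ℝ : (E →L[ℝ] E →L[ℝ] ℝ) →L[ℝ] (E →L[ℝ] E →L[ℝ] ℝ)).comp
      (fderiv ℝ G y).flip))

theorem koszul_apply (G : E → E →L[ℝ] E →L[ℝ] ℝ) (y u v w : E) :
    koszul G y u v w
      = (1 / 2) * (fderiv ℝ G y u v w + fderiv ℝ G y v u w - fderiv ℝ G y w u v) := rfl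

/-- The Christoffel symbols of the metric `G`, as a field of bilinear maps. -/
noncomputable def leviCivita (G : E → E →L[ℝ] E →L[ℝ] ℝ) (y : E) : E →L[ℝ] E →L[ℝ] E :=
  (ContinuousLinearMap.compL ℝ E (E →L[ℝ] ℝ) E (G y).inverse).comp (koszul G y)

theorem leviCivita_apply (G : E → E →L[ℝ] E →L[ℝ] ℝ) (y u v : E) :
    leviCivita G y u v = (G y).inverse (koszul G y u v) := rfl

/-- `G` is a smooth Riemannian metric on the open set `U`; its values outside `U` are arbitrary. -/
structure IsMetricOn (G : E → E →L[ℝ] E →L[ℝ] ℝ) (U : Set E) : Prop where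
  isOpen : IsOpen U
  contDiffOn : ContDiffOn ℝ ∞ G U
  symm : ∀ y ∈ U, ∀ u v, G y u v = G y v u
  pos : ∀ y ∈ U, ∀ v, v ≠ 0 → 0 < G y v v

theorem isInvertible_of_pos [FiniteDimensional ℝ E] {g : E →L[ℝ] E →L[ℝ] ℝ}
    (hpos : ∀ v, v ≠ 0 → 0 < g v v) : g.IsInvertible := by
  have hinj : Function.Injective (g : E →ₗ[ℝ] E →L[ℝ] ℝ) := by
    rw [injective_iff_map_eq_zero]
    intro v hv
    by_contra hv0
    have h := hpos v hv0
    have h2 : g v = 0 := hv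
    rw [h2] at h
    exact lt_irrefl _ h
  have hdim : Module.finrank ℝ E = Module.finrank ℝ (E →L[ℝ] ℝ) := by
    rw [← Subspace.dual_finrank_eq]
    exact (LinearMap.toContinuousLinearMap (𝕜 := ℝ) (E := E) (F' := ℝ)).finrank_eq
  exact ⟨(LinearEquiv.ofInjectiveOfFinrankEq (g : E →ₗ[ℝ] E →L[ℝ] ℝ) hinj
    hdim).toContinuousLinearEquiv, by ext; rfl⟩

namespace IsMetricOn

variable [FiniteDimensional ℝ E] {G : E → E →L[ℝ] E →L[ℝ] ℝ} {U : Set E}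

theorem isInvertible (hG : IsMetricOn G U) {y : E} (hy : y ∈ U) : (G y).IsInvertible :=
  isInvertible_of_pos (hG.pos y hy)

omit [FiniteDimensional ℝ E] in
theorem eq_of_forall (hG : IsMetricOn G U) {y : E} (hy : y ∈ U) {u v : E}
    (h : ∀ w, G y u w = G y v w) : u = v := by
  by_contra huv
  have h1 := hG.pos y hy (u - v) (sub_ne_zero.2 huv)
  have h2 := h (u - v)
  rw [map_sub (G y), sub_apply, h2, sub_self] at h1
  exact lt_irrefl _ h1

theorem apply_inverse (hG : IsMetricOn G U) {y : E} (hy : y ∈ U) (l : E →L[ℝ] ℝ) :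
    G y ((G y).inverse l) = l := by
  obtain ⟨e, he⟩ := hG.isInvertible hy
  rw [← he, ContinuousLinearMap.inverse_equiv]
  exact e.apply_symm_apply l

theorem apply_leviCivita (hG : IsMetricOn G U) {y : E} (hy : y ∈ U) (u v w : E) :
    G y (leviCivita G y u v) w
      = (1 / 2) * (fderiv ℝ G y u v w + fderiv ℝ G y v u w - fderiv ℝ G y w u v) := by
  rw [leviCivita_apply, hG.apply_inverse hy, koszul_apply]

omit [FiniteDimensional ℝ E] in
theorem contDiffAt (hG : IsMetricOn G U) {y : E} (hy : y ∈ U) : ContDiffAt ℝ ∞ G y :=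
  hG.contDiffOn.contDiffAt (hG.isOpen.mem_nhds hy)

omit [FiniteDimensional ℝ E] in
theorem differentiableAt (hG : IsMetricOn G U) {y : E} (hy : y ∈ U) : DifferentiableAt ℝ G y :=
  (hG.contDiffAt hy).differentiableAt (by simp)

omit [FiniteDimensional ℝ E] in
theorem fderiv_symm (hG : IsMetricOn G U) {y : E} (hy : y ∈ U) (a u v : E) :
    fderiv ℝ G y a u v = fderiv ℝ G y a v u := by
  have hd := hG.differentiableAt hy
  have e : (fun z ↦ G z u v) =ᶠ[𝓝 y] fun z ↦ G z v u := by
    filter_upwards [hG.isOpen.mem_nhds hy] with z hz using hG.symm z hz u v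
  have e' := DFunLike.congr_fun (e.fderiv_eq (𝕜 := ℝ)) a
  rwa [fderiv_clm_apply₂_const hd, fderiv_clm_apply₂_const hd] at e'

theorem leviCivita_symm (hG : IsMetricOn G U) {y : E} (hy : y ∈ U) (u v : E) :
    leviCivita G y u v = leviCivita G y v u := by
  refine hG.eq_of_forall hy fun w ↦ ?_
  rw [hG.apply_leviCivita hy, hG.apply_leviCivita hy, hG.fderiv_symm hy w u v]
  ring

/-- The Levi-Civita connection preserves the metric. -/
theorem fderiv_apply (hG : IsMetricOn G U) {y : E} (hy : y ∈ U) (a u v : E) :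
    fderiv ℝ G y a u v = G y (leviCivita G y a u) v + G y u (leviCivita G y a v) := by
  rw [hG.symm y hy u, hG.apply_leviCivita hy, hG.apply_leviCivita hy, hG.fderiv_symm hy a v u,
    hG.fderiv_symm hy u a v, hG.fderiv_symm hy v a u]
  ring

theorem contDiffOn_leviCivita (hG : IsMetricOn G U) : ContDiffOn ℝ ∞ (leviCivita G) U := by
  have hD : ContDiffOn ℝ ∞ (fderiv ℝ G) U := hG.contDiffOn.fderiv_of_isOpen hG.isOpen (by simp)
  have hflip : ContDiffOn ℝ ∞ (fun y ↦ (fderiv ℝ G y).flip) U :=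
    (ContinuousLinearMap.flipₗᵢ ℝ E E (E →L[ℝ] ℝ)).contDiff.comp_contDiffOn hD
  have hK : ContDiffOn ℝ ∞ (koszul G) U :=
    ((hD.add hflip).sub (contDiffOn_const.clm_comp hflip)).const_smul _
  have hinv : ContDiffOn ℝ ∞ (fun y ↦ (G y).inverse) U := fun y hy ↦
    ((hG.isInvertible hy).contDiffAt_map_inverse.comp y (hG.contDiffAt hy)).contDiffWithinAt
  exact ((ContinuousLinearMap.compL ℝ E (E →L[ℝ] ℝ) E).contDiff.comp_contDiffOn hinv).clm_comp hK

theorem contDiffAt_leviCivita (hG : IsMetricOn G U) {y : E} (hy : y ∈ U) :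
    ContDiffAt ℝ ∞ (leviCivita G) y :=
  hG.contDiffOn_leviCivita.contDiffAt (hG.isOpen.mem_nhds hy)

theorem differentiableAt_leviCivita (hG : IsMetricOn G U) {y : E} (hy : y ∈ U) :
    DifferentiableAt ℝ (leviCivita G) y :=
  (hG.contDiffAt_leviCivita hy).differentiableAt (by simp)

theorem fderiv_leviCivita_symm (hG : IsMetricOn G U) {y : E} (hy : y ∈ U) (a u v : E) :
    fderiv ℝ (leviCivita G) y a u v = fderiv ℝ (leviCivita G) y a v u := by
  have hd := hG.differentiableAt_leviCivita hy
  have e : (fun z ↦ leviCivita G z u v) =ᶠ[𝓝 y] fun z ↦ leviCivita G z v u := by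
    filter_upwards [hG.isOpen.mem_nhds hy] with z hz using hG.leviCivita_symm hz u v
  have e' := DFunLike.congr_fun (e.fderiv_eq (𝕜 := ℝ)) a
  rwa [fderiv_clm_apply₂_const hd, fderiv_clm_apply₂_const hd] at e'

omit [FiniteDimensional ℝ E] in
theorem _root_.connCurvature_swap (Γ : E → E →L[ℝ] E →L[ℝ] E) (y u v w : E) :
    connCurvature Γ y u v w = -connCurvature Γ y v u w := by
  simp only [connCurvature_apply]
  abel

/-- The first Bianchi identity. -/
theorem connCurvature_cyclic (hG : IsMetricOn G U) {y : E} (hy : y ∈ U) (u v w : E) :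
    connCurvature (leviCivita G) y u v w + connCurvature (leviCivita G) y v w u
      + connCurvature (leviCivita G) y w u v = 0 := by
  simp only [connCurvature_apply]
  rw [hG.fderiv_leviCivita_symm hy u w v, hG.fderiv_leviCivita_symm hy v w u,
    hG.fderiv_leviCivita_symm hy w v u, hG.leviCivita_symm hy w v, hG.leviCivita_symm hy w u,
    hG.leviCivita_symm hy v u]
  abel

/-- The curvature operators are skew-symmetric. -/
theorem connCurvature_skew (hG : IsMetricOn G U) {y : E} (hy : y ∈ U) (a b u v : E) :
    G y (connCurvature (leviCivita G) y a b u) v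
      + G y u (connCurvature (leviCivita G) y a b v) = 0 := by
  have hd := hG.differentiableAt hy
  have hΓ := hG.differentiableAt_leviCivita hy
  have hDG : DifferentiableAt ℝ (fderiv ℝ G) y :=
    ((hG.contDiffAt hy).fderiv_right (m := ∞) (by simp)).differentiableAt (by simp)
  -- The derivative in direction `a` of `D_b G(u, v) = G(∇_b u, v) + G(u, ∇_b v)`; the left side is
  -- symmetric in `a` and `b`.
  have key : ∀ a b, fderiv ℝ (fderiv ℝ G) y a b u v
      = fderiv ℝ G y a (leviCivita G y b u) v + G y (fderiv ℝ (leviCivita G) y a b u) v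
        + (fderiv ℝ G y a u (leviCivita G y b v)
          + G y u (fderiv ℝ (leviCivita G) y a b v)) := by
    intro a b
    have e : (fun z ↦ fderiv ℝ G z b u v) =ᶠ[𝓝 y] fun z ↦
        G z (leviCivita G z b u) v + G z u (leviCivita G z b v) := by
      filter_upwards [hG.isOpen.mem_nhds hy] with z hz using hG.fderiv_apply hz b u v
    have e' := DFunLike.congr_fun (e.fderiv_eq (𝕜 := ℝ)) a
    rw [fderiv_clm_apply₃_const hDG, fderiv_fun_add (by fun_prop) (by fun_prop), add_apply,
      fderiv_clm_apply₂ hd (by fun_prop) (by fun_prop),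
      fderiv_clm_apply₂ hd (by fun_prop) (by fun_prop), fderiv_clm_apply₂_const hΓ,
      fderiv_clm_apply₂_const hΓ] at e'
    simp only [fderiv_fun_const, Pi.zero_apply, zero_apply, map_zero, add_zero] at e'
    exact e'
  have hs : fderiv ℝ (fderiv ℝ G) y a b = fderiv ℝ (fderiv ℝ G) y b a :=
    ((hG.contDiffAt hy).isSymmSndFDerivAt (by simp; exact ENat.LEInfty.out)) a b
  have k1 := key a b
  have k2 := key b a
  rw [hs] at k1
  simp only [hG.fderiv_apply hy] at k1 k2
  simp only [connCurvature_apply, map_add, map_sub, add_apply, sub_apply]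
  linarith

end IsMetricOn

end Connections

/-! ### The transformation law of the Levi-Civita connection and Schur's lemma -/

section Schur

variable {E : Type*} [NormedAddCommGroup E] [NormedSpace ℝ E]
  {E' : Type*} [NormedAddCommGroup E'] [NormedSpace ℝ E']

/-- Transformation law of the Christoffel symbols: a local isometry intertwines the Levi-Civita
connections. -/
theorem fderiv_leviCivita [FiniteDimensional ℝ E] [FiniteDimensional ℝ E']
    {G : E → E →L[ℝ] E →L[ℝ] ℝ} {U : Set E} {G' : E' → E' →L[ℝ] E' →L[ℝ] ℝ} {U' : Set E'}
    (hG : IsMetricOn G U) (hG' : IsMetricOn G' U') {τ : E' → E} {y : E'} (hy : y ∈ U')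
    (hτy : τ y ∈ U) (hτ : ContDiffAt ℝ 2 τ y)
    (hsurj : Function.Surjective (fderiv ℝ τ y))
    (hpull : ∀ᶠ z in 𝓝 y, ∀ a b, G' z a b = G (τ z) (fderiv ℝ τ z a) (fderiv ℝ τ z b))
    (a b : E') :
    fderiv ℝ τ y (leviCivita G' y a b)
      = fderiv ℝ (fderiv ℝ τ) y a b + leviCivita G (τ y) (fderiv ℝ τ y a) (fderiv ℝ τ y b) := by
  have hA : DifferentiableAt ℝ (fderiv ℝ τ) y :=
    (hτ.fderiv_right (m := 1) (by norm_num)).differentiableAt (by norm_num)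
  have hτ' : DifferentiableAt ℝ τ y := hτ.differentiableAt (by norm_num)
  have hGτ : DifferentiableAt ℝ (fun z ↦ G (τ z)) y :=
    DifferentiableAt.comp y (g := G) (hG.differentiableAt hτy) hτ'
  have hs : ∀ a b, fderiv ℝ (fderiv ℝ τ) y a b = fderiv ℝ (fderiv ℝ τ) y b a := fun a b ↦
    (hτ.isSymmSndFDerivAt (by simp)) a b
  have key : ∀ a b c, fderiv ℝ G' y a b c
      = fderiv ℝ G (τ y) (fderiv ℝ τ y a) (fderiv ℝ τ y b) (fderiv ℝ τ y c)
        + G (τ y) (fderiv ℝ (fderiv ℝ τ) y a b) (fderiv ℝ τ y c)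
        + G (τ y) (fderiv ℝ (fderiv ℝ τ) y a c) (fderiv ℝ τ y b) := by
    intro a b c
    have e : (fun z ↦ G' z b c) =ᶠ[𝓝 y] fun z ↦
        G (τ z) (fderiv ℝ τ z b) (fderiv ℝ τ z c) := by
      filter_upwards [hpull] with z hz using hz b c
    have e' := DFunLike.congr_fun (e.fderiv_eq (𝕜 := ℝ)) a
    rw [fderiv_clm_apply₂_const (hG'.differentiableAt hy),
      fderiv_clm_apply₂ hGτ (by fun_prop) (by fun_prop), fderiv_clm_apply_const hA,
      fderiv_clm_apply_const hA] at e'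
    have hcomp : fderiv ℝ (fun z ↦ G (τ z)) y a = fderiv ℝ G (τ y) (fderiv ℝ τ y a) := by
      have := fderiv_comp y (g := G) (hG.differentiableAt hτy) hτ'
      exact DFunLike.congr_fun this a
    rw [hcomp] at e'
    rw [e', hG.symm _ hτy (fderiv ℝ τ y b)]
  refine hG.eq_of_forall hτy fun w ↦ ?_
  obtain ⟨c, rfl⟩ := hsurj w
  have h1 := hpull.self_of_nhds (leviCivita G' y a b) c
  rw [← h1, hG'.apply_leviCivita hy, map_add, add_apply, hG.apply_leviCivita hτy, key, key, key,
    hs b a, hs c a, hs c b]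
  ring

/-- **Schur's lemma**: by the second Bianchi identity, a pointwise constant sectional curvature `κ`
has vanishing derivative in dimension at least three. -/
theorem IsMetricOn.fderiv_eq_zero_of_connCurvature_eq [FiniteDimensional ℝ E]
    (hE : 2 < Module.finrank ℝ E) {G : E → E →L[ℝ] E →L[ℝ] ℝ} {U : Set E} (hG : IsMetricOn G U)
    {κ : E → ℝ} {y : E} (hy : y ∈ U) (hκ : DifferentiableAt ℝ κ y)
    (hR : ∀ᶠ z in 𝓝 y, ∀ u v w,
      connCurvature (leviCivita G) z u v w = κ z • (G z v w • u - G z u w • v)) :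
    fderiv ℝ κ y = 0 := by
  set Γ := leviCivita G with hΓdef
  have hΓ2 : ContDiffAt ℝ 2 Γ y := (hG.contDiffAt_leviCivita hy).of_le ENat.LEInfty.out
  have hΓ : DifferentiableAt ℝ Γ y := hG.differentiableAt_leviCivita hy
  have hDΓ : DifferentiableAt ℝ (fderiv ℝ Γ) y :=
    (hΓ2.fderiv_right (m := 1) (by norm_num)).differentiableAt (by norm_num)
  have hGd := hG.differentiableAt hy
  have hs : ∀ a b, fderiv ℝ (fderiv ℝ Γ) y a b = fderiv ℝ (fderiv ℝ Γ) y b a := fun a b ↦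
    (hΓ2.isSymmSndFDerivAt (by simp)) a b
  -- The derivative of the assumption `hR` in direction `a`.
  have key : ∀ a b c w,
      fderiv ℝ (fderiv ℝ Γ) y a b c w - fderiv ℝ (fderiv ℝ Γ) y a c b w
        + (fderiv ℝ Γ y a b (Γ y c w) + Γ y b (fderiv ℝ Γ y a c w))
        - (fderiv ℝ Γ y a c (Γ y b w) + Γ y c (fderiv ℝ Γ y a b w))
      = fderiv ℝ κ y a • (G y c w • b - G y b w • c)
        + κ y • (fderiv ℝ G y a c w • b - fderiv ℝ G y a b w • c) := by
    intro a b c w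
    have e : (fun z ↦ fderiv ℝ Γ z b c w - fderiv ℝ Γ z c b w + Γ z b (Γ z c w)
        - Γ z c (Γ z b w)) =ᶠ[𝓝 y] fun z ↦ κ z • (G z c w • b - G z b w • c) := by
      filter_upwards [hR] with z hz
      rw [← hz b c w, connCurvature_apply]
    have e' := DFunLike.congr_fun (e.fderiv_eq (𝕜 := ℝ)) a
    rw [fderiv_fun_sub (by fun_prop) (by fun_prop), fderiv_fun_add (by fun_prop) (by fun_prop),
      fderiv_fun_sub (by fun_prop) (by fun_prop), sub_apply, add_apply, sub_apply,
      fderiv_clm_apply₃_const hDΓ, fderiv_clm_apply₃_const hDΓ,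
      fderiv_clm_apply₂ hΓ (by fun_prop) (by fun_prop),
      fderiv_clm_apply₂ hΓ (by fun_prop) (by fun_prop),
      fderiv_clm_apply₂ hΓ (by fun_prop) (by fun_prop),
      fderiv_clm_apply₂ hΓ (by fun_prop) (by fun_prop), fderiv_fun_smul hκ (by fun_prop),
      fderiv_fun_sub (by fun_prop) (by fun_prop), fderiv_smul_const (by fun_prop),
      fderiv_smul_const (by fun_prop)] at e'
    simp only [fderiv_fun_const, Pi.zero_apply, zero_apply, map_zero, add_zero, add_apply,
      smul_apply, sub_apply, ContinuousLinearMap.smulRight_apply,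
      fderiv_clm_apply₂_const hGd] at e'
    rw [e']
    abel
  have hR0 := hR.self_of_nhds
  have hR1 : ∀ u v w, fderiv ℝ Γ y u v w - fderiv ℝ Γ y v u w + Γ y u (Γ y v w)
      - Γ y v (Γ y u w) = κ y • (G y v w • u - G y u w • v) := fun u v w ↦ by
    rw [← hR0, connCurvature_apply]
  -- The second Bianchi identity, with the curvature tensor replaced by its value.
  have bianchi : ∀ a b c w, fderiv ℝ κ y a • (G y c w • b - G y b w • c)
      + fderiv ℝ κ y b • (G y a w • c - G y c w • a)
      + fderiv ℝ κ y c • (G y b w • a - G y a w • b) = 0 := by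
    intro a b c w
    have k1 := key a b c w
    have k2 := key b c a w
    have k3 := key c a b w
    rw [hs b a] at k2
    rw [hs c a, hs c b] at k3
    have r1 := congrArg (Γ y a) (hR1 b c w)
    have r2 := congrArg (Γ y b) (hR1 c a w)
    have r3 := congrArg (Γ y c) (hR1 a b w)
    have q1 := hR1 b c (Γ y a w)
    have q2 := hR1 c a (Γ y b w)
    have q3 := hR1 a b (Γ y c w)
    simp only [map_add, map_sub, map_smul] at r1 r2 r3
    simp only [hG.fderiv_apply hy] at k1 k2 k3
    rw [← hΓdef] at k1 k2 k3
    have sba : Γ y b a = Γ y a b := hG.leviCivita_symm hy b a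
    have sca : Γ y c a = Γ y a c := hG.leviCivita_symm hy c a
    have scb : Γ y c b = Γ y b c := hG.leviCivita_symm hy c b
    rw [sba] at k2 r2
    rw [sca, scb] at k3 r3
    linear_combination (norm := module) q1 + q2 + q3 - r1 - r2 - r3 - k1 - k2 - k3
  ext a
  rw [zero_apply]
  rcases eq_or_ne a 0 with rfl | ha
  · exact map_zero _
  -- For independent `a`, `b`, `c`, the coefficient of `b` in the identity gives
  -- `κ'(a) G(c, w) = κ'(c) G(a, w)` for all `w`, hence `κ'(a) c = κ'(c) a` and `κ'(a) = 0`.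
  obtain ⟨b, hb⟩ := exists_notMem_of_finrank_lt
    ((finrank_span_singleton_le_one a).trans_lt (by omega : 1 < Module.finrank ℝ E))
  obtain ⟨c, hc⟩ := exists_notMem_of_finrank_lt ((finrank_span_pair_le b a).trans_lt hE)
  have hba : LinearIndependent ℝ ![b, a] := linearIndependent_pair_of_notMem_span ha hb
  have hind : LinearIndependent ℝ ![c, b, a] := by
    refine linearIndependent_finCons.2 ⟨hba, ?_⟩
    simpa [Set.pair_comm] using hc
  have hcoef : ∀ w, G y ((fderiv ℝ κ y a) • c - fderiv ℝ κ y c • a) w = 0 := by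
    intro w
    have h := bianchi a b c w
    have h' := Fintype.linearIndependent_iff.1 hind
      ![fderiv ℝ κ y b * G y a w - fderiv ℝ κ y a * G y b w,
        fderiv ℝ κ y a * G y c w - fderiv ℝ κ y c * G y a w,
        fderiv ℝ κ y c * G y b w - fderiv ℝ κ y b * G y c w] (by
        simp only [Fin.sum_univ_three, Matrix.cons_val_zero, Matrix.cons_val_one,
          Matrix.cons_val]
        rw [← h]
        module) 1
    simpa using h'
  have h0 : fderiv ℝ κ y a • c - fderiv ℝ κ y c • a = 0 :=
    hG.eq_of_forall hy fun w ↦ by rw [hcoef w, map_zero, zero_apply]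
  by_contra hne
  refine hc (Submodule.mem_span_pair.2 ⟨0, (fderiv ℝ κ y a)⁻¹ * fderiv ℝ κ y c, ?_⟩)
  rw [zero_smul, zero_add, mul_smul, ← sub_eq_zero.1 h0, smul_smul, inv_mul_cancel₀ hne, one_smul]

end Schur

/-! ### Second order differential equations -/

section SecondOrder

variable {E : Type*} [NormedAddCommGroup E] [NormedSpace ℝ E]
  {F : Type*} [NormedAddCommGroup F] [NormedSpace ℝ F]

/-- Local existence for second order differential equations `c'' = f(c, c')`. -/
theorem exists_deriv_deriv_eq [CompleteSpace E] {f : E × E → E} {q v : E}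
    (hf : ContDiffAt ℝ 1 f (q, v)) {U : Set E} (hU : U ∈ 𝓝 q) :
    ∃ c : ℝ → E, ∃ δ > 0, c 0 = q ∧ deriv c 0 = v ∧ ContDiffOn ℝ 2 c (Ioo (-δ) δ) ∧
      ∀ t ∈ Ioo (-δ) δ, c t ∈ U ∧ deriv (deriv c) t = f (c t, deriv c t) := by
  have hV : ContDiffAt ℝ 1 (fun p : E × E ↦ (p.2, f p)) (q, v) := contDiffAt_snd.prodMk hf
  obtain ⟨α, h0, ε, hε, hα⟩ :=
    hV.exists_forall_mem_closedBall_exists_eq_forall_mem_Ioo_hasDerivAt₀ 0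
  rw [zero_sub, zero_add] at hα
  have hcont : ContinuousAt α 0 := (hα 0 ⟨by linarith, hε⟩).continuousAt
  have hnear : ∀ᶠ t in 𝓝 (0 : ℝ), ContDiffAt ℝ 1 f (α t) ∧ (α t).1 ∈ U := by
    have h1 := hf.eventually (by simp)
    have h2 : ∀ᶠ p : E × E in 𝓝 (q, v), p.1 ∈ U := continuousAt_fst.eventually hU
    rw [← h0] at h1 h2
    exact hcont.eventually (h1.and h2)
  obtain ⟨η, hη, hball⟩ := Metric.eventually_nhds_iff.1 hnear
  have hη' : ∀ t ∈ Ioo (-min ε η) (min ε η), t ∈ Ioo (-ε) ε ∧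
      (ContDiffAt ℝ 1 f (α t) ∧ (α t).1 ∈ U) := by
    intro t ht
    have h1 := min_le_left ε η
    have h2 := min_le_right ε η
    refine ⟨⟨by linarith [ht.1], by linarith [ht.2]⟩, hball ?_⟩
    rw [Real.dist_eq, sub_zero, abs_lt]
    exact ⟨by linarith [ht.1], by linarith [ht.2]⟩
  have hd1 : ∀ t ∈ Ioo (-ε) ε, HasDerivAt (fun τ ↦ (α τ).1) (α t).2 t := fun t ht ↦
    (ContinuousLinearMap.fst ℝ E E).hasFDerivAt.comp_hasDerivAt t (hα t ht)
  have hd2 : ∀ t ∈ Ioo (-ε) ε, HasDerivAt (fun τ ↦ (α τ).2) (f (α t)) t := fun t ht ↦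
    (ContinuousLinearMap.snd ℝ E E).hasFDerivAt.comp_hasDerivAt t (hα t ht)
  have hderiv : ∀ t ∈ Ioo (-ε) ε, deriv (fun τ ↦ (α τ).1) t = (α t).2 := fun t ht ↦
    (hd1 t ht).deriv
  have hd3 : ∀ t ∈ Ioo (-ε) ε, HasDerivAt (deriv fun τ ↦ (α τ).1) (f (α t)) t := by
    intro t ht
    refine (hd2 t ht).congr_of_eventuallyEq ?_
    filter_upwards [isOpen_Ioo.mem_nhds ht] with τ hτ using hderiv τ hτ
  have h00 : (0 : ℝ) ∈ Ioo (-ε) ε := ⟨by linarith, hε⟩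
  refine ⟨fun τ ↦ (α τ).1, min ε η, lt_min hε hη, by simp [h0], by rw [hderiv 0 h00, h0], ?_, ?_⟩
  · have hsub : Ioo (-min ε η) (min ε η) ⊆ Ioo (-ε) ε := fun t ht ↦ (hη' t ht).1
    rw [show (2 : ℕ∞ω) = 0 + 1 + 1 by norm_num, contDiffOn_succ_iff_deriv_of_isOpen isOpen_Ioo,
      contDiffOn_succ_iff_deriv_of_isOpen isOpen_Ioo]
    refine ⟨fun t ht ↦ (hd1 t (hsub ht)).differentiableAt.differentiableWithinAt, by simp,
      fun t ht ↦ (hd3 t (hsub ht)).differentiableAt.differentiableWithinAt, by simp, ?_⟩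
    rw [contDiffOn_zero]
    refine ContinuousOn.congr (f := fun t ↦ f (α t)) (fun t ht ↦ ?_) fun t ht ↦
      (hd3 t (hsub ht)).deriv
    exact (ContinuousAt.comp (hη' t ht).2.1.continuousAt
      (hα t (hsub ht)).continuousAt).continuousWithinAt
  · intro t ht
    refine ⟨(hη' t ht).2.2, ?_⟩
    rw [(hd3 t (hη' t ht).1).deriv, hderiv t (hη' t ht).1]

theorem contDiffAt_deriv {g : ℝ → E} {t : ℝ} {m n : ℕ∞ω} (hg : ContDiffAt ℝ n g t)
    (hmn : m + 1 ≤ n) : ContDiffAt ℝ m (deriv g) t :=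
  (hg.fderiv_right hmn).clm_apply contDiffAt_const

/-- If the curve `c` lies in the zero set of `h` for small positive times, then the second
derivative of `h ∘ c` vanishes at `0`. -/
theorem fderiv_fderiv_add_eq_zero {h : E → F} {c : ℝ → E} (hh : ContDiffAt ℝ 2 h (c 0))
    (hc : ContDiffAt ℝ 2 c 0) (h0 : ∀ᶠ t in 𝓝[>] (0 : ℝ), h (c t) = 0) :
    fderiv ℝ (fderiv ℝ h) (c 0) (deriv c 0) (deriv c 0)
      + fderiv ℝ h (c 0) (deriv (deriv c) 0) = 0 := by
  have hg : ContDiffAt ℝ 2 (fun t ↦ h (c t)) 0 := ContDiffAt.comp 0 (g := h) hh hc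
  have hg2 : ContDiffAt ℝ 0 (deriv (deriv fun t ↦ h (c t))) 0 :=
    contDiffAt_deriv (contDiffAt_deriv (m := 1) hg (by norm_num)) (by norm_num)
  have hzero : ∀ᶠ t in 𝓝[>] (0 : ℝ), deriv (deriv fun t ↦ h (c t)) t = 0 := by
    obtain ⟨ε, hε, hlt⟩ := mem_nhdsGT_iff_exists_Ioo_subset.1 h0
    have hε' : (0 : ℝ) < ε := hε
    have hd1 : ∀ t ∈ Ioo 0 ε, deriv (fun t ↦ h (c t)) t = 0 := fun t ht ↦ by
      have e : (fun t ↦ h (c t)) =ᶠ[𝓝 t] fun _ ↦ 0 := by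
        filter_upwards [isOpen_Ioo.mem_nhds ht] with τ hτ using hlt hτ
      rw [e.deriv_eq, deriv_const]
    filter_upwards [Ioo_mem_nhdsGT hε'] with t ht
    have e : deriv (fun t ↦ h (c t)) =ᶠ[𝓝 t] fun _ ↦ 0 := by
      filter_upwards [isOpen_Ioo.mem_nhds ht] with τ hτ using hd1 τ hτ
    rw [e.deriv_eq, deriv_const]
  have hlim : deriv (deriv fun t ↦ h (c t)) 0 = 0 := by
    have h1 := (hg2.continuousAt.tendsto).mono_left (nhdsWithin_le_nhds (s := Ioi (0 : ℝ)))
    have h2 : Tendsto (deriv (deriv fun t ↦ h (c t))) (𝓝[>] (0 : ℝ)) (𝓝 0) :=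
      (tendsto_congr' hzero).2 tendsto_const_nhds
    exact tendsto_nhds_unique h1 h2
  rw [← hlim]
  have e : deriv (fun t ↦ h (c t)) =ᶠ[𝓝 0] fun t ↦ fderiv ℝ h (c t) (deriv c t) := by
    have h1 := hc.continuousAt.eventually (hh.eventually (by simp))
    filter_upwards [h1, hc.eventually (by simp)] with t ht1 ht2
    exact ((ht1.differentiableAt (by norm_num)).hasFDerivAt.comp_hasDerivAt t
      (ht2.differentiableAt (by norm_num)).hasDerivAt).deriv
  rw [e.deriv_eq]
  have hd1 : HasDerivAt (fun t ↦ fderiv ℝ h (c t)) (fderiv ℝ (fderiv ℝ h) (c 0) (deriv c 0)) 0 :=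
    (((hh.fderiv_right (m := 1) (by norm_num)).differentiableAt
      (by norm_num)).hasFDerivAt.comp_hasDerivAt (0 : ℝ)
      (hc.differentiableAt (by norm_num)).hasDerivAt)
  have hd2 : HasDerivAt (deriv c) (deriv (deriv c) 0) 0 :=
    ((contDiffAt_deriv (m := 1) (n := 2) hc (by norm_num)).differentiableAt (by norm_num)).hasDerivAt
  exact (hd1.clm_apply hd2).deriv.symm

end SecondOrder

/-! ### Slices of a coordinate system -/

section Slices

variable {E : Type*} [NormedAddCommGroup E] [NormedSpace ℝ E]
  {E' : Type*} [NormedAddCommGroup E'] [NormedSpace ℝ E']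
  {F : Type*} [NormedAddCommGroup F] [NormedSpace ℝ F]

/-- `f` parametrizes the slice `{Φ₂ = 0}` of the local coordinate system `Φ = (Φ₁, Φ₂)`, with
inverse `Φ₁`. -/
structure IsSlice (f : E' → E) (Φ : E → E' × F) (V : Set E') (O : Set E) : Prop where
  isOpen_source : IsOpen V
  isOpen_target : IsOpen O
  contDiffOn_param : ContDiffOn ℝ ∞ f V
  contDiffOn_coord : ContDiffOn ℝ ∞ Φ O
  mapsTo : MapsTo f V O
  coord_param : ∀ y ∈ V, Φ (f y) = (y, 0)
  injective_fderiv : ∀ x ∈ O, Function.Injective (fderiv ℝ Φ x)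

namespace IsSlice

variable {f : E' → E} {Φ : E → E' × F} {V : Set E'} {O : Set E}

theorem contDiffAt_param (hS : IsSlice f Φ V O) {y : E'} (hy : y ∈ V) : ContDiffAt ℝ ∞ f y :=
  hS.contDiffOn_param.contDiffAt (hS.isOpen_source.mem_nhds hy)

theorem contDiffAt_coord (hS : IsSlice f Φ V O) {x : E} (hx : x ∈ O) : ContDiffAt ℝ ∞ Φ x :=
  hS.contDiffOn_coord.contDiffAt (hS.isOpen_target.mem_nhds hx)

theorem fderiv_coord (hS : IsSlice f Φ V O) {y : E'} (hy : y ∈ V) (a : E') :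
    fderiv ℝ Φ (f y) (fderiv ℝ f y a) = (a, 0) := by
  have hf := (hS.contDiffAt_param hy).differentiableAt (by simp)
  have hΦ := (hS.contDiffAt_coord (hS.mapsTo hy)).differentiableAt (by simp)
  have e : Φ ∘ f =ᶠ[𝓝 y] ContinuousLinearMap.inl ℝ E' F := by
    filter_upwards [hS.isOpen_source.mem_nhds hy] with z hz using hS.coord_param z hz
  have e' := DFunLike.congr_fun (e.fderiv_eq (𝕜 := ℝ)) a
  rw [fderiv_comp y hΦ hf, ContinuousLinearMap.fderiv] at e'
  exact e'

theorem contDiffAt_snd (hS : IsSlice f Φ V O) {x : E} (hx : x ∈ O) :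
    ContDiffAt ℝ ∞ (fun x ↦ (Φ x).2) x := (hS.contDiffAt_coord hx).snd

theorem fderiv_snd (hS : IsSlice f Φ V O) {x : E} (hx : x ∈ O) (v : E) :
    fderiv ℝ (fun x ↦ (Φ x).2) x v = (fderiv ℝ Φ x v).2 := by
  have hΦ := (hS.contDiffAt_coord hx).differentiableAt (by simp)
  rw [hΦ.hasFDerivAt.snd.fderiv]
  rfl

/-- The tangent space of the slice is the kernel of `DΦ₂`. -/
theorem fderiv_param_fst (hS : IsSlice f Φ V O) {y : E'} (hy : y ∈ V) {v : E}
    (hv : fderiv ℝ (fun x ↦ (Φ x).2) (f y) v = 0) :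
    fderiv ℝ f y (fderiv ℝ Φ (f y) v).1 = v := by
  refine hS.injective_fderiv _ (hS.mapsTo hy) ?_
  rw [hS.fderiv_coord hy]
  rw [hS.fderiv_snd (hS.mapsTo hy)] at hv
  exact Prod.ext rfl hv.symm

/-- The second derivative of `Φ₂ ∘ f = 0`. -/
theorem fderiv_snd_fderiv_fderiv (hS : IsSlice f Φ V O) {y : E'} (hy : y ∈ V) (a b : E') :
    fderiv ℝ (fderiv ℝ fun x ↦ (Φ x).2) (f y) (fderiv ℝ f y a) (fderiv ℝ f y b)
      + fderiv ℝ (fun x ↦ (Φ x).2) (f y) (fderiv ℝ (fderiv ℝ f) y a b) = 0 := by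
  have hh := hS.contDiffAt_snd (hS.mapsTo hy)
  have hf := hS.contDiffAt_param hy
  have hDf : DifferentiableAt ℝ (fderiv ℝ f) y :=
    (hf.fderiv_right (m := ∞) (by simp)).differentiableAt (by simp)
  have hDh : DifferentiableAt ℝ (fderiv ℝ fun x ↦ (Φ x).2) (f y) :=
    (hh.fderiv_right (m := ∞) (by simp)).differentiableAt (by simp)
  have hf' : DifferentiableAt ℝ f y := hf.differentiableAt (by simp)
  have hDhf : DifferentiableAt ℝ (fun z ↦ fderiv ℝ (fun x ↦ (Φ x).2) (f z)) y :=
    DifferentiableAt.comp y (g := fderiv ℝ fun x ↦ (Φ x).2) hDh hf'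
  have e : (fun z ↦ fderiv ℝ (fun x ↦ (Φ x).2) (f z) (fderiv ℝ f z b)) =ᶠ[𝓝 y] fun _ ↦ 0 := by
    filter_upwards [hS.isOpen_source.mem_nhds hy] with z hz
    rw [hS.fderiv_snd (hS.mapsTo hz), hS.fderiv_coord hz]
  have e' := DFunLike.congr_fun (e.fderiv_eq (𝕜 := ℝ)) a
  rw [fderiv_clm_apply_apply hDhf (by fun_prop), fderiv_clm_apply_const hDf] at e'
  have hcomp : fderiv ℝ (fun z ↦ fderiv ℝ (fun x ↦ (Φ x).2) (f z)) y a
      = fderiv ℝ (fderiv ℝ fun x ↦ (Φ x).2) (f y) (fderiv ℝ f y a) := by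
    have := fderiv_comp y (g := fderiv ℝ fun x ↦ (Φ x).2) hDh hf'
    exact DFunLike.congr_fun this a
  rw [hcomp] at e'
  simpa using e'

variable {G : E → E →L[ℝ] E →L[ℝ] ℝ} {U : Set E}

/-- The condition that the slice is tangent to second order to the solutions of
`c'' + Γ(c', c') = Z(c')` of speed `s` splits, under `w ↦ -w`, into its odd part, saying that `Z`
preserves the tangent spaces, and its even part, saying that the slice is totally geodesic. -/
theorem fderiv_snd_eq_zero_and (hS : IsSlice f Φ V O) (hG : IsMetricOn G U) (hOU : O ⊆ U)
    {s : ℝ} (hs : 0 < s) {Z : E → E →L[ℝ] E} {y : E'} (hy : y ∈ V)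
    (hmag : ∀ a, G (f y) (fderiv ℝ f y a) (fderiv ℝ f y a) = s ^ 2 →
      fderiv ℝ (fderiv ℝ fun x ↦ (Φ x).2) (f y) (fderiv ℝ f y a) (fderiv ℝ f y a)
        + fderiv ℝ (fun x ↦ (Φ x).2) (f y) (Z (f y) (fderiv ℝ f y a)
          - leviCivita G (f y) (fderiv ℝ f y a) (fderiv ℝ f y a)) = 0) (a : E') :
    fderiv ℝ (fun x ↦ (Φ x).2) (f y) (Z (f y) (fderiv ℝ f y a)) = 0 ∧
      fderiv ℝ (fderiv ℝ fun x ↦ (Φ x).2) (f y) (fderiv ℝ f y a) (fderiv ℝ f y a)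
        = fderiv ℝ (fun x ↦ (Φ x).2) (f y)
          (leviCivita G (f y) (fderiv ℝ f y a) (fderiv ℝ f y a)) := by
  have hyU : f y ∈ U := hOU (hS.mapsTo hy)
  by_cases ha : fderiv ℝ f y a = 0
  · simp [ha]
  have hpos := hG.pos _ hyU _ ha
  -- With this factor, the vectors `± r • Df(a)` have speed `s`.
  set r : ℝ := s / √(G (f y) (fderiv ℝ f y a) (fderiv ℝ f y a)) with hr
  have hr0 : r ≠ 0 := (div_pos hs (Real.sqrt_pos.2 hpos)).ne'
  have hr2 : r ^ 2 * G (f y) (fderiv ℝ f y a) (fderiv ℝ f y a) = s ^ 2 := by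
    rw [hr, div_pow, Real.sq_sqrt hpos.le, div_mul_cancel₀ _ hpos.ne']
  have key : ∀ ρ : ℝ, ρ ^ 2 = r ^ 2 →
      ρ ^ 2 • fderiv ℝ (fderiv ℝ fun x ↦ (Φ x).2) (f y) (fderiv ℝ f y a) (fderiv ℝ f y a)
        + (ρ • fderiv ℝ (fun x ↦ (Φ x).2) (f y) (Z (f y) (fderiv ℝ f y a))
          - ρ ^ 2 • fderiv ℝ (fun x ↦ (Φ x).2) (f y)
            (leviCivita G (f y) (fderiv ℝ f y a) (fderiv ℝ f y a))) = 0 := by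
    intro ρ hρ
    have h := hmag (ρ • a) (by
      simp only [map_smul, smul_apply, smul_eq_mul]
      rw [← hr2, ← hρ]
      ring)
    simp only [map_smul, smul_apply, map_sub] at h
    rw [← h]
    module
  have k1 := key r rfl
  have k2 := key (-r) (by ring)
  constructor
  · have h : (2 * r) • fderiv ℝ (fun x ↦ (Φ x).2) (f y) (Z (f y) (fderiv ℝ f y a)) = 0 := by
      linear_combination (norm := module) k1 - k2
    exact (smul_eq_zero.1 h).resolve_left (by simpa using hr0)
  · have h : (2 * r ^ 2) • (fderiv ℝ (fderiv ℝ fun x ↦ (Φ x).2) (f y) (fderiv ℝ f y a)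
        (fderiv ℝ f y a) - fderiv ℝ (fun x ↦ (Φ x).2) (f y)
          (leviCivita G (f y) (fderiv ℝ f y a) (fderiv ℝ f y a))) = 0 := by
      linear_combination (norm := module) k1 + k2
    exact sub_eq_zero.1 ((smul_eq_zero.1 h).resolve_left (by simpa using hr0))

/-- The tangent spaces of a slice which is totally geodesic are invariant under the curvature: the
connection of the ambient space restricts to a connection of the slice. -/
theorem exists_fderiv_eq_connCurvature [FiniteDimensional ℝ E] (hS : IsSlice f Φ V O)
    (hG : IsMetricOn G U) (hOU : O ⊆ U)
    (hII : ∀ y ∈ V, ∀ a, fderiv ℝ (fderiv ℝ fun x ↦ (Φ x).2) (f y) (fderiv ℝ f y a)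
      (fderiv ℝ f y a) = fderiv ℝ (fun x ↦ (Φ x).2) (f y)
          (leviCivita G (f y) (fderiv ℝ f y a) (fderiv ℝ f y a)))
    {y : E'} (hy : y ∈ V) (a b c : E') :
    ∃ d, fderiv ℝ f y d = connCurvature (leviCivita G) (f y) (fderiv ℝ f y a) (fderiv ℝ f y b)
      (fderiv ℝ f y c) := by
  have hII' : ∀ z ∈ V, ∀ a b, fderiv ℝ (fderiv ℝ fun x ↦ (Φ x).2) (f z) (fderiv ℝ f z a)
      (fderiv ℝ f z b) = fderiv ℝ (fun x ↦ (Φ x).2) (f z)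
          (leviCivita G (f z) (fderiv ℝ f z a) (fderiv ℝ f z b)) := by
    intro z hz a b
    have hsymm : fderiv ℝ (fderiv ℝ fun x ↦ (Φ x).2) (f z) (fderiv ℝ f z b) (fderiv ℝ f z a)
        = fderiv ℝ (fderiv ℝ fun x ↦ (Φ x).2) (f z) (fderiv ℝ f z a) (fderiv ℝ f z b) :=
      ((hS.contDiffAt_snd (hS.mapsTo hz)).isSymmSndFDerivAt
        (by simp; exact ENat.LEInfty.out)) _ _
    have h1 := hII z hz (a + b)
    simp only [map_add, add_apply] at h1
    rw [hII z hz a, hII z hz b, hsymm,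
      hG.leviCivita_symm (hOU (hS.mapsTo hz)) (fderiv ℝ f z b) (fderiv ℝ f z a)] at h1
    have h2 : (2 : ℝ) • (fderiv ℝ (fderiv ℝ fun x ↦ (Φ x).2) (f z) (fderiv ℝ f z a)
      (fderiv ℝ f z b) - fderiv ℝ (fun x ↦ (Φ x).2) (f z)
          (leviCivita G (f z) (fderiv ℝ f z a) (fderiv ℝ f z b))) = 0 := by
      linear_combination (norm := module) h1
    exact sub_eq_zero.1 ((smul_eq_zero.1 h2).resolve_left two_ne_zero)
  -- The connection of the slice: `D²f(a, c) + Γ(Df a, Df c)` is tangent to the slice, and `DΦ₁` is a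
  -- left inverse of `Df`.
  let C : E' → E' →L[ℝ] E' →L[ℝ] E' := fun z ↦
    (ContinuousLinearMap.compL ℝ E' E E'
      ((ContinuousLinearMap.fst ℝ E' F).comp (fderiv ℝ Φ (f z)))).comp
    (fderiv ℝ (fderiv ℝ f) z + ((ContinuousLinearMap.compL ℝ E' E E).flip (fderiv ℝ f z)).comp
      ((leviCivita G (f z)).comp (fderiv ℝ f z)))
  have hCapply : ∀ z a c, C z a c = (fderiv ℝ Φ (f z) (fderiv ℝ (fderiv ℝ f) z a c
      + leviCivita G (f z) (fderiv ℝ f z a) (fderiv ℝ f z c))).1 := fun z a c ↦ rfl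
  have hf := hS.contDiffAt_param hy
  have hf' : DifferentiableAt ℝ f y := hf.differentiableAt (by simp)
  have hDf : DifferentiableAt ℝ (fderiv ℝ f) y :=
    (hf.fderiv_right (m := ∞) (by simp)).differentiableAt (by simp)
  have hDDf : DifferentiableAt ℝ (fderiv ℝ (fderiv ℝ f)) y :=
    ((hf.fderiv_right (m := ∞) (by simp)).fderiv_right (m := ∞) (by simp)).differentiableAt
      (by simp)
  have hDΦ : DifferentiableAt ℝ (fun z ↦ fderiv ℝ Φ (f z)) y :=
    DifferentiableAt.comp y (g := fderiv ℝ Φ) (((hS.contDiffAt_coord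
      (hS.mapsTo hy)).fderiv_right (m := ∞) (by simp)).differentiableAt (by simp)) hf'
  have hΓ := hG.differentiableAt_leviCivita (hOU (hS.mapsTo hy))
  have hΓf : DifferentiableAt ℝ (fun z ↦ leviCivita G (f z)) y :=
    DifferentiableAt.comp y (g := leviCivita G) hΓ hf'
  have hC : DifferentiableAt ℝ C y := by
    refine DifferentiableAt.clm_comp ?_ (hDDf.add (DifferentiableAt.clm_comp ?_
      (hΓf.clm_comp hDf)))
    · exact (ContinuousLinearMap.differentiableAt _).comp y
        ((differentiableAt_const _).clm_comp hDΦ)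
    · exact (ContinuousLinearMap.differentiableAt _).comp y hDf
  refine ⟨connCurvature C y a b c, fderiv_connCurvature (hf.of_le ENat.LEInfty.out) hΓ hC ?_ a b c⟩
  filter_upwards [hS.isOpen_source.mem_nhds hy] with z hz a c
  rw [hCapply]
  refine hS.fderiv_param_fst hz ?_
  rw [map_add, ← hII' z hz, add_comm]
  exact hS.fderiv_snd_fderiv_fderiv hz a c

end IsSlice

end Slices

/-! ### Metric, force and geodesics in charts -/

section TangentMaps

variable {E : Type*} [NormedAddCommGroup E] [NormedSpace ℝ E] {H : Type*} [TopologicalSpace H]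
  {I : ModelWithCorners ℝ E H} {M : Type*} [TopologicalSpace M] [ChartedSpace H M]
  {E' : Type*} [NormedAddCommGroup E'] [NormedSpace ℝ E'] {H' : Type*} [TopologicalSpace H']
  {I' : ModelWithCorners ℝ E' H'} {M' : Type*} [TopologicalSpace M'] [ChartedSpace H' M']

theorem tangentMap_congr {f g : M → M'} {p : TangentBundle I M} (h : f =ᶠ[𝓝 p.1] g) :
    tangentMap I I' f p = tangentMap I I' g p := by
  refine TotalSpace.ext h.eq_of_nhds ?_
  have h1 : (mfderiv I I' f p.1 : E →L[ℝ] E') = mfderiv I I' g p.1 := h.mfderiv_eq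
  exact heq_of_eq (DFunLike.congr_fun h1 p.2)

/-- A left inverse of `f` near a point induces a left inverse of the tangent map. The statement is
made in the tangent bundle because `g (f x)` and `x` are different base points for the type
theory. -/
theorem tangentMap_tangentMap_of_leftInverse {f : M → M'} {g : M' → M} {p : TangentBundle I M}
    (hf : MDifferentiableAt I I' f p.1) (hg : MDifferentiableAt I' I g (f p.1))
    (h : ∀ᶠ z in 𝓝 p.1, g (f z) = z) : tangentMap I' I g (tangentMap I I' f p) = p := by
  refine (tangentMap_comp_at p hg hf).symm.trans ((tangentMap_congr (g := id) h).trans ?_)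
  rw [tangentMap_id]
  rfl

theorem exists_eq_mk_of_proj_eq {q : TangentBundle I M} {p : M} (h : q.1 = p) :
    ∃ w : TangentSpace I p, q = ⟨p, w⟩ := by
  subst h
  exact ⟨q.2, rfl⟩

end TangentMaps

section Charts

variable {n : ℕ} {M : Type*} [TopologicalSpace M] [ChartedSpace (EuclideanSpace ℝ (Fin n)) M]

local notation "𝔼" => EuclideanSpace ℝ (Fin n)

theorem christoffel_eq (g : BilinField n M) (x₀ : M) (y u v : 𝔼) :
    christoffel g x₀ y u v = leviCivita (g.inChart x₀) y u v := rfl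

theorem isOpen_extChartAt_target_euclidean (x₀ : M) : IsOpen (extChartAt (𝓡 n) x₀).target :=
  isOpen_extChartAt_target x₀

variable [IsManifold (𝓡 n) ∞ M]

theorem contMDiffAt_extChartAt_symm {x₀ : M} {y : 𝔼} (hy : y ∈ (extChartAt (𝓡 n) x₀).target) :
    ContMDiffAt 𝓘(ℝ, 𝔼) (𝓡 n) ∞ (extChartAt (𝓡 n) x₀).symm y :=
  (contMDiffOn_extChartAt_symm x₀).contMDiffAt
    ((isOpen_extChartAt_target_euclidean x₀).mem_nhds hy)

theorem mdifferentiableAt_extChartAt_symm {x₀ : M} {y : 𝔼}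
    (hy : y ∈ (extChartAt (𝓡 n) x₀).target) :
    MDifferentiableAt 𝓘(ℝ, 𝔼) (𝓡 n) (extChartAt (𝓡 n) x₀).symm y :=
  (contMDiffAt_extChartAt_symm hy).mdifferentiableAt (by simp)

theorem mdifferentiableAt_extChartAt_of_mem {x₀ x : M} (hx : x ∈ (extChartAt (𝓡 n) x₀).source) :
    MDifferentiableAt (𝓡 n) 𝓘(ℝ, 𝔼) (extChartAt (𝓡 n) x₀) x :=
  mdifferentiableAt_extChartAt (by rwa [extChartAt_source] at hx)

theorem mfderiv_extChartAt_mfderiv_symm {x₀ : M} {y : 𝔼}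
    (hy : y ∈ (extChartAt (𝓡 n) x₀).target) (u : 𝔼) :
    mfderiv (𝓡 n) 𝓘(ℝ, 𝔼) (extChartAt (𝓡 n) x₀) ((extChartAt (𝓡 n) x₀).symm y)
      (mfderiv 𝓘(ℝ, 𝔼) (𝓡 n) (extChartAt (𝓡 n) x₀).symm y u) = u := by
  have h := mfderiv_extChartAt_comp_mfderivWithin_extChartAt_symm hy
  rw [ModelWithCorners.range_eq_univ, mfderivWithin_univ] at h
  exact DFunLike.congr_fun h u

theorem mfderiv_symm_mfderiv_extChartAt {x₀ x : M} (hx : x ∈ (extChartAt (𝓡 n) x₀).source)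
    (v : TangentSpace (𝓡 n) x) :
    mfderiv 𝓘(ℝ, 𝔼) (𝓡 n) (extChartAt (𝓡 n) x₀).symm (extChartAt (𝓡 n) x₀ x)
      (mfderiv (𝓡 n) 𝓘(ℝ, 𝔼) (extChartAt (𝓡 n) x₀) x v) = v := by
  have h := mfderivWithin_extChartAt_symm_comp_mfderiv_extChartAt' hx
  rw [ModelWithCorners.range_eq_univ, mfderivWithin_univ] at h
  exact DFunLike.congr_fun h v

theorem tangentMap_extChartAt_tangentMap_symm {x₀ : M} {y : 𝔼}
    (hy : y ∈ (extChartAt (𝓡 n) x₀).target) (u : 𝔼) :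
    tangentMap (𝓡 n) 𝓘(ℝ, 𝔼) (extChartAt (𝓡 n) x₀)
      (tangentMap 𝓘(ℝ, 𝔼) (𝓡 n) (extChartAt (𝓡 n) x₀).symm ⟨y, u⟩) = ⟨y, u⟩ := by
  refine tangentMap_tangentMap_of_leftInverse (mdifferentiableAt_extChartAt_symm hy)
    (mdifferentiableAt_extChartAt_of_mem ((extChartAt (𝓡 n) x₀).map_target hy)) ?_
  filter_upwards [(isOpen_extChartAt_target_euclidean x₀).mem_nhds hy] with z hz
    using (extChartAt (𝓡 n) x₀).right_inv hz

/-- A smooth field of bilinear forms has smooth coordinate expressions. -/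
theorem BilinField.contDiffOn_inChart {b : BilinField n M}
    (hb : ContMDiff (𝓡 n) ((𝓡 n).prod 𝓘(ℝ, 𝔼 →L[ℝ] 𝔼 →L[ℝ] ℝ)) ∞
      (fun x ↦ TotalSpace.mk' (𝔼 →L[ℝ] 𝔼 →L[ℝ] ℝ) x (b x))) (x₀ : M) :
    ContDiffOn ℝ ∞ (b.inChart x₀) (extChartAt (𝓡 n) x₀).target := by
  have hopen := isOpen_extChartAt_target_euclidean (n := n) x₀
  have hsection : ∀ u : 𝔼, ContMDiffOn 𝓘(ℝ, 𝔼) ((𝓡 n).prod 𝓘(ℝ, 𝔼)) ∞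
      (fun y ↦ (TotalSpace.mk' 𝔼 ((extChartAt (𝓡 n) x₀).symm y)
        (mfderiv 𝓘(ℝ, 𝔼) (𝓡 n) (extChartAt (𝓡 n) x₀).symm y u) : TangentBundle (𝓡 n) M))
      (extChartAt (𝓡 n) x₀).target := by
    intro u
    have h1 := (contMDiffOn_extChartAt_symm (I := 𝓡 n) (n := ∞) x₀).contMDiffOn_tangentMapWithin
      (m := ∞) (by simp) hopen.uniqueMDiffOn
    have h2 : ContMDiff 𝓘(ℝ, 𝔼) 𝓘(ℝ, 𝔼).tangent ∞
        (fun y ↦ (TotalSpace.mk' 𝔼 y u : TangentBundle 𝓘(ℝ, 𝔼) 𝔼)) :=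
      contMDiff_vectorSpace_iff_contDiff.2 contDiff_const
    refine (h1.comp h2.contMDiffOn fun y hy ↦ hy).congr fun y hy ↦ ?_
    simp only [Function.comp, tangentMapWithin]
    rw [mfderivWithin_of_isOpen hopen hy]
  refine contDiffOn_clm_apply.2 fun u ↦ contDiffOn_clm_apply.2 fun v ↦ ?_
  have h : ContMDiffOn 𝓘(ℝ, 𝔼) ((𝓡 n).prod 𝓘(ℝ)) ∞
      (fun y ↦ TotalSpace.mk' ℝ (E := Bundle.Trivial M ℝ) ((extChartAt (𝓡 n) x₀).symm y)
        (b.inChart x₀ y u v)) (extChartAt (𝓡 n) x₀).target := by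
    apply ContMDiffOn.clm_bundle_apply₂ (F₁ := 𝔼) (F₂ := 𝔼)
    · exact hb.comp_contMDiffOn (contMDiffOn_extChartAt_symm x₀)
    · exact hsection u
    · exact hsection v
  intro y hy
  have h2 := h y hy
  rw [contMDiffWithinAt_totalSpace] at h2
  exact h2.2.contDiffWithinAt

/-- In each chart the metric is a smooth Riemannian metric on the target of the chart. -/
theorem MagneticSystem.isMetricOn_inChart (S : MagneticSystem n M) (x₀ : M) :
    IsMetricOn (BilinField.inChart S.metric.inner x₀) (extChartAt (𝓡 n) x₀).target where
  isOpen := isOpen_extChartAt_target_euclidean x₀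
  contDiffOn := BilinField.contDiffOn_inChart S.metric.contMDiff x₀
  symm y _ u v := S.metric.symm _ _ _
  pos y hy v hv := by
    refine S.metric.pos _ _ fun h0 ↦ hv ?_
    exact (mfderiv_extChartAt_mfderiv_symm hy v).symm.trans
      ((congrArg (mfderiv (𝓡 n) 𝓘(ℝ, 𝔼) (extChartAt (𝓡 n) x₀) _) h0).trans (map_zero _))

/-- The Lorentz force in the chart at `x₀`. -/
noncomputable def MagneticSystem.forceInChart (S : MagneticSystem n M) (x₀ : M) (y : 𝔼) :
    𝔼 →L[ℝ] 𝔼 :=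
  (BilinField.inChart S.metric.inner x₀ y).inverse.comp (S.form.inChart x₀ y)

theorem MagneticSystem.inChart_forceInChart (S : MagneticSystem n M) {x₀ : M} {y : 𝔼}
    (hy : y ∈ (extChartAt (𝓡 n) x₀).target) (u v : 𝔼) :
    BilinField.inChart S.metric.inner x₀ y (S.forceInChart x₀ y u) v
      = S.form.inChart x₀ y u v := by
  rw [MagneticSystem.forceInChart, ContinuousLinearMap.comp_apply,
    (S.isMetricOn_inChart x₀).apply_inverse hy]

theorem MagneticSystem.contDiffOn_forceInChart (S : MagneticSystem n M) (x₀ : M) :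
    ContDiffOn ℝ ∞ (S.forceInChart x₀) (extChartAt (𝓡 n) x₀).target := by
  have hG := S.isMetricOn_inChart x₀
  refine ContDiffOn.clm_comp (fun y hy ↦ ?_) (BilinField.contDiffOn_inChart S.form_smooth x₀)
  exact ((hG.isInvertible hy).contDiffAt_map_inverse.comp y (hG.contDiffAt hy)).contDiffWithinAt

theorem MagneticSystem.metric_lorentzForce (S : MagneticSystem n M) (x : M)
    (v w : TangentSpace (𝓡 n) x) : S.metric.inner x (S.lorentzForce x v) w = S.form x v w := by
  have hinv : (S.metric.inner x : 𝔼 →L[ℝ] 𝔼 →L[ℝ] ℝ).IsInvertible :=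
    isInvertible_of_pos (E := 𝔼) (g := S.metric.inner x) (S.metric.pos x)
  obtain ⟨e, he⟩ := hinv
  have h : (S.metric.inner x : 𝔼 →L[ℝ] 𝔼 →L[ℝ] ℝ)
      (ContinuousLinearMap.inverse (S.metric.inner x : 𝔼 →L[ℝ] 𝔼 →L[ℝ] ℝ)
        (S.form x v : 𝔼 →L[ℝ] ℝ)) = S.form x v := by
    rw [← he, ContinuousLinearMap.inverse_equiv]
    exact e.apply_symm_apply _
  exact DFunLike.congr_fun h w

/-- The Lorentz force transforms as a tangent vector. -/
theorem MagneticSystem.mfderiv_lorentzForce (S : MagneticSystem n M) {x₀ : M} {y : 𝔼}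
    (hy : y ∈ (extChartAt (𝓡 n) x₀).target) (u : 𝔼) :
    mfderiv (𝓡 n) 𝓘(ℝ, 𝔼) (extChartAt (𝓡 n) x₀) ((extChartAt (𝓡 n) x₀).symm y)
      (S.lorentzForce _ (mfderiv 𝓘(ℝ, 𝔼) (𝓡 n) (extChartAt (𝓡 n) x₀).symm y u))
      = S.forceInChart x₀ y u := by
  refine (S.isMetricOn_inChart x₀).eq_of_forall hy fun w ↦ ?_
  refine Eq.trans ?_ (S.inChart_forceInChart hy u w).symm
  refine Eq.trans ?_ (S.metric_lorentzForce _
    (mfderiv 𝓘(ℝ, 𝔼) (𝓡 n) (extChartAt (𝓡 n) x₀).symm y u)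
    (mfderiv 𝓘(ℝ, 𝔼) (𝓡 n) (extChartAt (𝓡 n) x₀).symm y w))
  have h := mfderiv_symm_mfderiv_extChartAt ((extChartAt (𝓡 n) x₀).map_target hy)
    (S.lorentzForce _ (mfderiv 𝓘(ℝ, 𝔼) (𝓡 n) (extChartAt (𝓡 n) x₀).symm y u))
  rw [(extChartAt (𝓡 n) x₀).right_inv hy] at h
  exact congrArg (fun z : TangentSpace (𝓡 n) ((extChartAt (𝓡 n) x₀).symm y) ↦
    S.metric.inner _ z (mfderiv 𝓘(ℝ, 𝔼) (𝓡 n) (extChartAt (𝓡 n) x₀).symm y w)) h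

/-- The velocity of a curve given in the chart at `x₀`. -/
theorem curveVelocity_extChartAt_symm_comp {x₀ : M} {c : ℝ → 𝔼} {t : ℝ}
    (ht : c t ∈ (extChartAt (𝓡 n) x₀).target) (hc : DifferentiableAt ℝ c t) :
    curveVelocity (n := n) (fun τ ↦ (extChartAt (𝓡 n) x₀).symm (c τ)) t
      = mfderiv 𝓘(ℝ, 𝔼) (𝓡 n) (extChartAt (𝓡 n) x₀).symm (c t) (deriv c t) := by
  have h := (mdifferentiableAt_extChartAt_symm ht).hasMFDerivAt.comp t
    hc.mdifferentiableAt.hasMFDerivAt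
  have h2 := DFunLike.congr_fun (h.mfderiv) (1 : ℝ)
  have h3 : mfderiv 𝓘(ℝ, ℝ) 𝓘(ℝ, 𝔼) c t (1 : ℝ) = deriv c t := by
    rw [mfderiv_eq_fderiv]
    rfl
  exact h2.trans (congrArg (mfderiv 𝓘(ℝ, 𝔼) (𝓡 n) (extChartAt (𝓡 n) x₀).symm (c t)) h3)

/-- A solution of the magnetic geodesic equation in a chart is a magnetic geodesic. -/
theorem MagneticSystem.isMagneticGeodesicOn_symm_comp (S : MagneticSystem n M) {x₀ : M}
    {c : ℝ → 𝔼} {J : Set ℝ} (hJ : IsOpen J) (hc : ContDiffOn ℝ 2 c J)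
    (h : ∀ t ∈ J, c t ∈ (extChartAt (𝓡 n) x₀).target ∧ deriv (deriv c) t
      = S.forceInChart x₀ (c t) (deriv c t)
        - leviCivita (BilinField.inChart S.metric.inner x₀) (c t) (deriv c t) (deriv c t)) :
    S.IsMagneticGeodesicOn (fun τ ↦ (extChartAt (𝓡 n) x₀).symm (c τ)) J := by
  refine ⟨((contMDiffOn_extChartAt_symm (n := ∞) x₀).of_le ENat.LEInfty.out).comp
    hc.contMDiffOn fun t ht ↦ (h t ht).1, fun t ht ↦ ⟨x₀,
    (extChartAt (𝓡 n) x₀).map_target (h t ht).1, ?_⟩⟩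
  have e : (fun τ ↦ extChartAt (𝓡 n) x₀ ((extChartAt (𝓡 n) x₀).symm (c τ))) =ᶠ[𝓝 t] c := by
    filter_upwards [hJ.mem_nhds ht] with τ hτ
    exact (extChartAt (𝓡 n) x₀).right_inv (h τ hτ).1
  have hcd : DifferentiableAt ℝ c t :=
    (hc.contDiffAt (hJ.mem_nhds ht)).differentiableAt (by norm_num)
  have hl : deriv (deriv fun τ ↦ extChartAt (𝓡 n) x₀ ((extChartAt (𝓡 n) x₀).symm (c τ))) t
      + christoffel S.metric.inner x₀ (extChartAt (𝓡 n) x₀ ((extChartAt (𝓡 n) x₀).symm (c t)))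
        (deriv (fun τ ↦ extChartAt (𝓡 n) x₀ ((extChartAt (𝓡 n) x₀).symm (c τ))) t)
        (deriv (fun τ ↦ extChartAt (𝓡 n) x₀ ((extChartAt (𝓡 n) x₀).symm (c τ))) t)
      = S.forceInChart x₀ (c t) (deriv c t) := by
    rw [e.deriv.deriv_eq, e.deriv_eq, e.eq_of_nhds, christoffel_eq, (h t ht).2]
    abel
  exact hl.trans ((congrArg (fun v : TangentSpace (𝓡 n) ((extChartAt (𝓡 n) x₀).symm (c t)) ↦
    mfderiv (𝓡 n) 𝓘(ℝ, 𝔼) (extChartAt (𝓡 n) x₀) _ (S.lorentzForce _ v))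
    (curveVelocity_extChartAt_symm_comp (h t ht).1 hcd)).trans
    (S.mfderiv_lorentzForce (h t ht).1 _)).symm

end Charts

/-! ### Totally magnetic immersions -/

section Immersions

variable {n k : ℕ} {M : Type*} [TopologicalSpace M] [ChartedSpace (EuclideanSpace ℝ (Fin n)) M]
  {N : Type*} [TopologicalSpace N] [ChartedSpace (EuclideanSpace ℝ (Fin k)) N]

local notation "𝔼" => EuclideanSpace ℝ (Fin n)
local notation "𝔽" => EuclideanSpace ℝ (Fin k)

/-- An immersed submanifold seen in a chart of `M` and near a point `p` of `N`: with a chart `ψ` of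
`N`, the immersion becomes a map `f` which parametrizes a slice of a coordinate system `Φ`. -/
theorem exists_isSlice [IsManifold (𝓡 n) ∞ M] [IsManifold (𝓡 k) ∞ N] {ι : N → M}
    (hι : IsImmersion (𝓡 k) (𝓡 n) ∞ ι) (x₀ : M) (p : N) :
    ∃ (F : Type) (_ : NormedAddCommGroup F) (_ : NormedSpace ℝ F)
      (ψ : OpenPartialHomeomorph N 𝔽) (f : 𝔽 → 𝔼) (Φ : 𝔼 → 𝔽 × F) (V : Set 𝔽) (O : Set 𝔼),
      ψ ∈ IsManifold.maximalAtlas (𝓡 k) ∞ N ∧ p ∈ ψ.source ∧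
      V = ψ.target ∩ ψ.symm ⁻¹' (ι ⁻¹' (extChartAt (𝓡 n) x₀).source) ∧
      (∀ y, f y = extChartAt (𝓡 n) x₀ (ι (ψ.symm y))) ∧
      IsSlice f Φ V O ∧ O ⊆ (extChartAt (𝓡 n) x₀).target := by
  have hsmooth := hι.contMDiff
  obtain ⟨F, _, _, hF⟩ := hι
  have hp' := hF p
  set φ := extChartAt (𝓡 n) x₀ with hφ
  have hφs : IsOpen φ.source := isOpen_extChartAt_source x₀
  have hφt : IsOpen φ.target := isOpen_extChartAt_target_euclidean x₀
  have hdom := hp'.domChart_mem_maximalAtlas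
  have hcod := hp'.codChart_mem_maximalAtlas
  set ψ := hp'.domChart with hψ
  set χ := hp'.codChart with hχ
  set e := hp'.equiv with he
  have hwritten : ∀ y ∈ ψ.target, χ (ι (ψ.symm y)) = e (y, 0) := by
    intro y hy
    have hy' : y ∈ (hp'.domChart.extend (𝓡 k)).target := by
      simpa using hy
    have h := hp'.writtenInCharts hy'
    simpa using h
  have hsub : ∀ z ∈ ψ.source, ι z ∈ χ.source := fun z hz ↦ hp'.source_subset_preimage_source hz
  have hV : IsOpen (ψ.target ∩ ψ.symm ⁻¹' (ι ⁻¹' φ.source)) :=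
    ψ.symm.isOpen_inter_preimage (hφs.preimage hsmooth.continuous)
  have hO : IsOpen (φ.target ∩ φ.symm ⁻¹' χ.source) :=
    (continuousOn_extChartAt_symm x₀).isOpen_inter_preimage hφt χ.open_source
  have hχs : ContMDiffOn (𝓡 n) 𝓘(ℝ, 𝔼) ∞ χ χ.source := contMDiffOn_of_mem_maximalAtlas hcod
  have hχt : ContMDiffOn 𝓘(ℝ, 𝔼) (𝓡 n) ∞ χ.symm χ.target :=
    contMDiffOn_symm_of_mem_maximalAtlas hcod
  have hψt : ContMDiffOn 𝓘(ℝ, 𝔽) (𝓡 k) ∞ ψ.symm ψ.target :=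
    contMDiffOn_symm_of_mem_maximalAtlas hdom
  have hφsm : ContMDiffOn (𝓡 n) 𝓘(ℝ, 𝔼) ∞ φ φ.source := by
    rw [hφ, extChartAt_source]
    exact contMDiffOn_extChartAt
  have hφtm : ContMDiffOn 𝓘(ℝ, 𝔼) (𝓡 n) ∞ φ.symm φ.target := contMDiffOn_extChartAt_symm x₀
  have hΦ : ContDiffOn ℝ ∞ (fun x ↦ e.symm (χ (φ.symm x))) (φ.target ∩ φ.symm ⁻¹' χ.source) := by
    refine e.symm.contDiff.comp_contDiffOn ?_
    exact (hχs.comp (hφtm.mono inter_subset_left) fun x hx ↦ hx.2).contDiffOn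
  refine ⟨F, _, _, ψ, fun y ↦ φ (ι (ψ.symm y)), fun x ↦ e.symm (χ (φ.symm x)), _,
    φ.target ∩ φ.symm ⁻¹' χ.source, hdom, hp'.mem_domChart_source, rfl, fun y ↦ rfl,
    ⟨hV, hO, ?_, hΦ, ?_, ?_, ?_⟩, inter_subset_left⟩
  · refine ContMDiffOn.contDiffOn ?_
    exact hφsm.comp (hsmooth.comp_contMDiffOn (hψt.mono inter_subset_left)) fun y hy ↦ hy.2
  · intro y hy
    have h1 : φ.symm (φ (ι (ψ.symm y))) = ι (ψ.symm y) := φ.left_inv hy.2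
    refine ⟨φ.map_source hy.2, ?_⟩
    rw [mem_preimage, h1]
    exact hsub _ (ψ.map_target hy.1)
  · intro y hy
    have h1 : φ.symm (φ (ι (ψ.symm y))) = ι (ψ.symm y) := φ.left_inv hy.2
    change e.symm (χ (φ.symm (φ (ι (ψ.symm y))))) = (y, 0)
    rw [h1, hwritten y hy.1, e.symm_apply_apply]
  · intro x hx
    -- The coordinate change `Φ` has the smooth left inverse `φ ∘ χ⁻¹ ∘ e`.
    have hΦd : DifferentiableAt ℝ (fun x ↦ e.symm (χ (φ.symm x))) x :=
      (hΦ.contDiffAt (hO.mem_nhds hx)).differentiableAt (by simp)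
    have hinv : ContDiffAt ℝ ∞ (fun z ↦ φ (χ.symm z)) (χ (φ.symm x)) := by
      have h1 : ContMDiffAt 𝓘(ℝ, 𝔼) (𝓡 n) ∞ χ.symm (χ (φ.symm x)) :=
        hχt.contMDiffAt (χ.open_target.mem_nhds (χ.map_source hx.2))
      have h3 : χ.symm (χ (φ.symm x)) = φ.symm x := χ.left_inv hx.2
      have h2 : ContMDiffAt (𝓡 n) 𝓘(ℝ, 𝔼) ∞ φ (χ.symm (χ (φ.symm x))) := by
        rw [h3]
        exact hφsm.contMDiffAt (hφs.mem_nhds (φ.map_target hx.1))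
      exact (h2.comp _ h1).contDiffAt
    have hinvd : DifferentiableAt ℝ (fun z ↦ φ (χ.symm (e z))) (e.symm (χ (φ.symm x))) := by
      refine DifferentiableAt.comp (g := fun z ↦ φ (χ.symm z)) _ ?_ e.differentiableAt
      rw [e.apply_symm_apply]
      exact hinv.differentiableAt (by simp)
    have hid : (fun z ↦ φ (χ.symm (e z))) ∘ (fun x ↦ e.symm (χ (φ.symm x))) =ᶠ[𝓝 x] id := by
      filter_upwards [hO.mem_nhds hx] with z hz
      simp only [Function.comp, e.apply_symm_apply, id]
      rw [χ.left_inv hz.2, φ.right_inv hz.1]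
    have h := hid.fderiv_eq (𝕜 := ℝ)
    rw [fderiv_comp x hinvd hΦd, fderiv_id] at h
    intro u v huv
    have h1 := DFunLike.congr_fun h u
    have h2 := DFunLike.congr_fun h v
    rw [ContinuousLinearMap.comp_apply] at h1 h2
    rw [huv] at h1
    exact h1.symm.trans h2

/-- The tangent spaces of an immersed submanifold, in a chart of `M`. -/
theorem tangentMap_immersion [IsManifold (𝓡 n) ∞ M] [IsManifold (𝓡 k) ∞ N] {ι : N → M}
    (hι : IsImmersion (𝓡 k) (𝓡 n) ∞ ι) {x₀ : M} {ψ : OpenPartialHomeomorph N 𝔽}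
    (hψ : ψ ∈ IsManifold.maximalAtlas (𝓡 k) ∞ N) {f : 𝔽 → 𝔼} {V : Set 𝔽} (hVo : IsOpen V)
    (hV : V = ψ.target ∩ ψ.symm ⁻¹' (ι ⁻¹' (extChartAt (𝓡 n) x₀).source))
    (hf : ∀ y, f y = extChartAt (𝓡 n) x₀ (ι (ψ.symm y))) {y : 𝔽} (hy : y ∈ V)
    (hfd : DifferentiableAt ℝ f y) (a : 𝔽) :
    tangentMap (𝓡 k) (𝓡 n) ι (tangentMap 𝓘(ℝ, 𝔽) (𝓡 k) ψ.symm ⟨y, a⟩)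
      = tangentMap 𝓘(ℝ, 𝔼) (𝓡 n) (extChartAt (𝓡 n) x₀).symm ⟨f y, fderiv ℝ f y a⟩ := by
  have hy' := hy
  rw [hV] at hy'
  have hψd : MDifferentiableAt 𝓘(ℝ, 𝔽) (𝓡 k) ψ.symm y :=
    ((contMDiffOn_symm_of_mem_maximalAtlas hψ).contMDiffAt
      (ψ.open_target.mem_nhds hy'.1)).mdifferentiableAt (by simp)
  have hιd : MDifferentiableAt (𝓡 k) (𝓡 n) ι (ψ.symm y) :=
    hι.contMDiff.contMDiffAt.mdifferentiableAt (by simp)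
  have hfy : f y ∈ (extChartAt (𝓡 n) x₀).target := by
    rw [hf]
    exact (extChartAt (𝓡 n) x₀).map_source hy'.2
  have hφd := mdifferentiableAt_extChartAt_symm hfy
  have e : ι ∘ ψ.symm =ᶠ[𝓝 y] (extChartAt (𝓡 n) x₀).symm ∘ f := by
    filter_upwards [hVo.mem_nhds hy] with z hz
    rw [hV] at hz
    simp only [Function.comp, hf]
    exact ((extChartAt (𝓡 n) x₀).left_inv hz.2).symm
  have h1 := tangentMap_comp_at (I := 𝓘(ℝ, 𝔽)) (I' := 𝓡 k) (I'' := 𝓡 n) (f := ψ.symm) (g := ι)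
    ⟨y, a⟩ hιd hψd
  have h2 := tangentMap_comp_at (I := 𝓘(ℝ, 𝔽)) (I' := 𝓘(ℝ, 𝔼)) (I'' := 𝓡 n) (f := f)
    (g := (extChartAt (𝓡 n) x₀).symm) ⟨y, a⟩ hφd hfd.mdifferentiableAt
  have h3 : tangentMap 𝓘(ℝ, 𝔽) 𝓘(ℝ, 𝔼) f ⟨y, a⟩ = ⟨f y, fderiv ℝ f y a⟩ := by
    simp only [tangentMap, mfderiv_eq_fderiv]
    rfl
  rw [h3] at h2
  exact h1.symm.trans ((tangentMap_congr (p := ⟨y, a⟩) e).trans h2)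

end Immersions

section TotallyMagnetic

variable {n k : ℕ} {M : Type*} [TopologicalSpace M] [ChartedSpace (EuclideanSpace ℝ (Fin n)) M]
  [IsManifold (𝓡 n) ∞ M]
  {N : Type*} [TopologicalSpace N] [ChartedSpace (EuclideanSpace ℝ (Fin k)) N]
  [IsManifold (𝓡 k) ∞ N]

local notation "𝔼" => EuclideanSpace ℝ (Fin n)
local notation "𝔽" => EuclideanSpace ℝ (Fin k)

/-- A totally `s`-magnetic submanifold is tangent to second order to the magnetic geodesics of
speed `s`: since these stay in the zero set of `Φ₂`, the second derivative of `Φ₂` along them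
vanishes. -/
theorem MagneticSystem.IsTotallyMagnetic.second_order {S : MagneticSystem n M} {s : ℝ}
    {ι : N → M} (hmag : S.IsTotallyMagnetic (k := k) s ι)
    (hι : IsImmersion (𝓡 k) (𝓡 n) ∞ ι) {x₀ : M} {ψ : OpenPartialHomeomorph N 𝔽}
    (hψ : ψ ∈ IsManifold.maximalAtlas (𝓡 k) ∞ N) {F : Type*} [NormedAddCommGroup F]
    [NormedSpace ℝ F] {f : 𝔽 → 𝔼} {Φ : 𝔼 → 𝔽 × F} {V : Set 𝔽} {O : Set 𝔼}
    (hV : V = ψ.target ∩ ψ.symm ⁻¹' (ι ⁻¹' (extChartAt (𝓡 n) x₀).source))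
    (hf : ∀ y, f y = extChartAt (𝓡 n) x₀ (ι (ψ.symm y)))
    (hS : IsSlice f Φ V O) (hO : O ⊆ (extChartAt (𝓡 n) x₀).target) {y : 𝔽} (hy : y ∈ V) (a : 𝔽)
    (hspeed : BilinField.inChart S.metric.inner x₀ (f y) (fderiv ℝ f y a) (fderiv ℝ f y a)
      = s ^ 2) :
    fderiv ℝ (fderiv ℝ fun x ↦ (Φ x).2) (f y) (fderiv ℝ f y a) (fderiv ℝ f y a)
      + fderiv ℝ (fun x ↦ (Φ x).2) (f y) (S.forceInChart x₀ (f y) (fderiv ℝ f y a)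
        - leviCivita (BilinField.inChart S.metric.inner x₀) (f y) (fderiv ℝ f y a)
          (fderiv ℝ f y a)) = 0 := by
  set φ := extChartAt (𝓡 n) x₀ with hφ
  have hG := S.isMetricOn_inChart x₀
  have hfO := hS.mapsTo hy
  have hft := hO hfO
  have hrhs : ContDiffAt ℝ 1 (fun p : 𝔼 × 𝔼 ↦ S.forceInChart x₀ p.1 p.2
      - leviCivita (BilinField.inChart S.metric.inner x₀) p.1 p.2 p.2)
      (f y, fderiv ℝ f y a) := by
    have h1 : ContDiffAt ℝ ∞ (fun p : 𝔼 × 𝔼 ↦ S.forceInChart x₀ p.1) (f y, fderiv ℝ f y a) :=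
      ContDiffAt.comp (f y, fderiv ℝ f y a) (g := S.forceInChart x₀)
        ((S.contDiffOn_forceInChart x₀).contDiffAt (hG.isOpen.mem_nhds hft)) contDiffAt_fst
    have h2 : ContDiffAt ℝ ∞ (fun p : 𝔼 × 𝔼 ↦
        leviCivita (BilinField.inChart S.metric.inner x₀) p.1) (f y, fderiv ℝ f y a) :=
      ContDiffAt.comp (f y, fderiv ℝ f y a)
        (g := leviCivita (BilinField.inChart S.metric.inner x₀))
        (hG.contDiffAt_leviCivita hft) contDiffAt_fst
    exact ((h1.clm_apply contDiffAt_snd).sub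
      ((h2.clm_apply contDiffAt_snd).clm_apply contDiffAt_snd)).of_le ENat.LEInfty.out
  obtain ⟨c, δ, hδ, hc0, hc0', hc2, hc⟩ :=
    exists_deriv_deriv_eq hrhs (hS.isOpen_target.mem_nhds hfO)
  have h0 : (0 : ℝ) ∈ Ioo (-δ) δ := ⟨by linarith, hδ⟩
  have hcat : ContDiffAt ℝ 2 c 0 := hc2.contDiffAt (isOpen_Ioo.mem_nhds h0)
  have hcd : DifferentiableAt ℝ c 0 := hcat.differentiableAt (by norm_num)
  have hgeo : S.IsMagneticGeodesicOn (fun τ ↦ φ.symm (c τ)) (Ioo (-δ) δ) :=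
    S.isMagneticGeodesicOn_symm_comp isOpen_Ioo hc2 fun t ht ↦ ⟨hO (hc t ht).1, (hc t ht).2⟩
  have hvel := curveVelocity_extChartAt_symm_comp (x₀ := x₀) (hO (hc 0 h0).1) hcd
  have htan := tangentMap_immersion hι hψ hS.isOpen_source hV hf hy
    ((hS.contDiffAt_param hy).differentiableAt (by simp)) a
  have hstart : (⟨φ.symm (c 0), curveVelocity (n := n) (fun τ ↦ φ.symm (c τ)) 0⟩ :
      TangentBundle (𝓡 n) M) = tangentMap 𝓘(ℝ, 𝔼) (𝓡 n) φ.symm ⟨c 0, fderiv ℝ f y a⟩ := by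
    refine TotalSpace.ext rfl (heq_of_eq ?_)
    exact hvel.trans (congrArg
      (mfderiv 𝓘(ℝ, 𝔼) (𝓡 n) (extChartAt (𝓡 n) x₀).symm (c 0)) hc0')
  have hbase : tangentMap 𝓘(ℝ, 𝔼) (𝓡 n) φ.symm ⟨c 0, fderiv ℝ f y a⟩
      = tangentMap 𝓘(ℝ, 𝔼) (𝓡 n) φ.symm ⟨f y, fderiv ℝ f y a⟩ :=
    congrArg (fun q : 𝔼 ↦ tangentMap 𝓘(ℝ, 𝔼) (𝓡 n) φ.symm ⟨q, fderiv ℝ f y a⟩) hc0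
  have hspeed' : S.metric.inner (φ.symm (c 0))
      (curveVelocity (n := n) (fun τ ↦ φ.symm (c τ)) 0)
      (curveVelocity (n := n) (fun τ ↦ φ.symm (c τ)) 0) = s ^ 2 := by
    have h1 : S.metric.inner (φ.symm (c 0))
      (curveVelocity (n := n) (fun τ ↦ φ.symm (c τ)) 0)
      (curveVelocity (n := n) (fun τ ↦ φ.symm (c τ)) 0)
        = BilinField.inChart S.metric.inner x₀ (c 0) (deriv c 0) (deriv c 0) := by
      rw [hvel]
      rfl
    rw [h1, hc0, hc0', hspeed]
  obtain ⟨ε, hε, γ, hγ, hγ0, hγx⟩ := hmag (ψ.symm y) _ _ δ hδ hgeo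
    ((hstart.trans hbase).trans htan.symm) hspeed'
  have hyV := hy
  rw [hV] at hyV
  have hzero : ∀ᶠ t in 𝓝[>] (0 : ℝ), (Φ (c t)).2 = 0 := by
    have hopen : IsOpen (ψ.source ∩ ι ⁻¹' φ.source) :=
      ψ.open_source.inter ((isOpen_extChartAt_source x₀).preimage hι.contMDiff.continuous)
    have hγc : Tendsto γ (𝓝[>] 0) (𝓝 (γ 0)) :=
      ((hγ 0 ⟨le_rfl, hε⟩).tendsto).mono_left
        (nhdsWithin_le_of_mem (Filter.mem_of_superset (Ioo_mem_nhdsGT hε) Ioo_subset_Ico_self))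
    -- As `γ` is continuous for the topology of `N`, it stays in the domain of the chart `ψ` for small
    -- times, where `ι` parametrizes the slice.
    have h1 : ∀ᶠ t in 𝓝[>] (0 : ℝ), γ t ∈ ψ.source ∩ ι ⁻¹' φ.source := by
      refine hγc.eventually (hopen.mem_nhds ?_)
      rw [hγ0]
      exact ⟨ψ.map_target hyV.1, hyV.2⟩
    filter_upwards [h1, Ioo_mem_nhdsGT hε, Ioo_mem_nhdsGT hδ] with t ht htε htδ
    have hct := hc t ⟨by linarith [htδ.1], htδ.2⟩
    have hyt : ψ.symm (ψ (γ t)) = γ t := ψ.left_inv ht.1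
    have hmem : ψ (γ t) ∈ V := by
      rw [hV]
      refine ⟨ψ.map_source ht.1, ?_⟩
      rw [mem_preimage, hyt]
      exact ht.2
    have hft : f (ψ (γ t)) = c t := by
      rw [hf, hyt, hγx t ⟨htε.1.le, htε.2⟩]
      exact φ.right_inv (hO hct.1)
    rw [← hft, hS.coord_param _ hmem]
  have hfinal := fderiv_fderiv_add_eq_zero (h := fun x ↦ (Φ x).2) (c := c)
    (((hS.contDiffAt_snd (hc 0 h0).1)).of_le ENat.LEInfty.out) hcat hzero
  rw [(hc 0 h0).2, hc0', hc0] at hfinal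
  exact hfinal

/-- If a plane `W` at the point `y` of a chart is tangent to a totally `s`-magnetic submanifold,
then it is invariant under the Lorentz force and under the curvature. -/
theorem MagneticSystem.mem_of_isTangentToTotallyMagnetic {S : MagneticSystem n M} {s : ℝ}
    (hs : 0 < s) {x₀ : M} {y : 𝔼} (hy : y ∈ (extChartAt (𝓡 n) x₀).target)
    {W : Submodule ℝ 𝔼} {W' : Submodule ℝ (TangentSpace (𝓡 n) ((extChartAt (𝓡 n) x₀).symm y))}
    (hW : ∀ u : 𝔼, u ∈ W ↔ mfderiv 𝓘(ℝ, 𝔼) (𝓡 n) (extChartAt (𝓡 n) x₀).symm y u ∈ W')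
    (h : S.IsTangentToTotallyMagnetic s k ((extChartAt (𝓡 n) x₀).symm y) W') :
    (∀ u ∈ W, S.forceInChart x₀ y u ∈ W) ∧
      ∀ u ∈ W, ∀ v ∈ W, ∀ w ∈ W,
        connCurvature (leviCivita (BilinField.inChart S.metric.inner x₀)) y u v w ∈ W := by
  obtain ⟨N, _, _, _, _, _, ι, p, hι, hιp, htan, hmag⟩ := h
  set φ := extChartAt (𝓡 n) x₀ with hφ
  have hpφ : ι p ∈ φ.source := by
    rw [hιp]
    exact φ.map_target hy
  obtain ⟨F, _, _, ψ, f, Φ, V, O, hψ, hpψ, hV, hf, hS, hO⟩ := exists_isSlice hι x₀ p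
  have hG := S.isMetricOn_inChart x₀
  have hψp : ψ.symm (ψ p) = p := ψ.left_inv hpψ
  have hpV : ψ p ∈ V := by
    rw [hV]
    refine ⟨ψ.map_source hpψ, ?_⟩
    rw [mem_preimage, hψp]
    exact hpφ
  have hfp : f (ψ p) = y := by
    rw [hf, hψp, hιp]
    exact φ.right_inv hy
  have htan2 := tangentMap_immersion hι hψ hS.isOpen_source hV hf hpV
    ((hS.contDiffAt_param hpV).differentiableAt (by simp))
  rw [hfp] at htan2
  -- In the chart, `W` is the tangent space of the slice.
  have hrange : ∀ u, u ∈ W ↔ ∃ a, fderiv ℝ f (ψ p) a = u := by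
    intro u
    rw [hW, htan]
    constructor
    · rintro ⟨w, hw⟩
      have hψd : MDifferentiableAt (𝓡 k) 𝓘(ℝ, 𝔽) ψ p :=
        ((contMDiffOn_of_mem_maximalAtlas hψ).contMDiffAt
          (ψ.open_source.mem_nhds hpψ)).mdifferentiableAt (by simp)
      have hψd' : MDifferentiableAt 𝓘(ℝ, 𝔽) (𝓡 k) ψ.symm (ψ p) :=
        ((contMDiffOn_symm_of_mem_maximalAtlas hψ).contMDiffAt
          (ψ.open_target.mem_nhds (ψ.map_source hpψ))).mdifferentiableAt (by simp)
      have hinv : tangentMap 𝓘(ℝ, 𝔽) (𝓡 k) ψ.symm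
          ⟨ψ p, mfderiv (𝓡 k) 𝓘(ℝ, 𝔽) ψ p w⟩ = (⟨p, w⟩ : TangentBundle (𝓡 k) N) := by
        refine tangentMap_tangentMap_of_leftInverse (p := (⟨p, w⟩ : TangentBundle (𝓡 k) N))
          hψd hψd' ?_
        filter_upwards [ψ.open_source.mem_nhds hpψ] with z hz using ψ.left_inv hz
      refine ⟨mfderiv (𝓡 k) 𝓘(ℝ, 𝔽) ψ p w, ?_⟩
      have h1 := htan2 (mfderiv (𝓡 k) 𝓘(ℝ, 𝔽) ψ p w)
      rw [hinv, hw] at h1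
      have h2 := congrArg (tangentMap (𝓡 n) 𝓘(ℝ, 𝔼) φ) h1
      have h3 := (tangentMap_extChartAt_tangentMap_symm hy u).symm.trans
        (h2.trans (tangentMap_extChartAt_tangentMap_symm hy _))
      exact (eq_of_heq (TotalSpace.mk.inj h3).2).symm
    · rintro ⟨a, rfl⟩
      obtain ⟨w, hw⟩ := exists_eq_mk_of_proj_eq (p := p)
        (q := tangentMap 𝓘(ℝ, 𝔽) (𝓡 k) ψ.symm ⟨ψ p, a⟩) hψp
      refine ⟨w, ?_⟩
      rw [← hw, htan2 a]
      rfl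
  have hsplit : ∀ z ∈ V, ∀ a, _ := fun z hz a ↦
    hS.fderiv_snd_eq_zero_and hG hO hs (Z := S.forceInChart x₀) hz
      (fun a ha ↦ hmag.second_order hι hψ hV hf hS hO hz a ha) a
  constructor
  · intro u hu
    obtain ⟨a, rfl⟩ := (hrange u).1 hu
    refine (hrange _).2
      ⟨(fderiv ℝ Φ (f (ψ p)) (S.forceInChart x₀ y (fderiv ℝ f (ψ p) a))).1, ?_⟩
    refine hS.fderiv_param_fst hpV ?_
    have h1 := (hsplit _ hpV a).1
    rwa [hfp] at h1 ⊢
  · intro u hu v hv w hw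
    obtain ⟨a, rfl⟩ := (hrange u).1 hu
    obtain ⟨b, rfl⟩ := (hrange v).1 hv
    obtain ⟨c, rfl⟩ := (hrange w).1 hw
    obtain ⟨d, hd⟩ := hS.exists_fderiv_eq_connCurvature hG hO (fun z hz a ↦ (hsplit z hz a).2)
      hpV a b c
    rw [hfp] at hd
    exact (hrange _).2 ⟨d, hd⟩

end TotallyMagnetic

/-! ### Constant curvature -/

section ConstantCurvature

variable {n : ℕ} {M : Type*} [TopologicalSpace M] [ChartedSpace (EuclideanSpace ℝ (Fin n)) M]

local notation "𝔼" => EuclideanSpace ℝ (Fin n)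

theorem BilinField.apply_eq_of_mk_eq (b : BilinField n M) {x x' : M}
    {u v : TangentSpace (𝓡 n) x} {u' v' : TangentSpace (𝓡 n) x'}
    (hu : (⟨x, u⟩ : TangentBundle (𝓡 n) M) = ⟨x', u'⟩)
    (hv : (⟨x, v⟩ : TangentBundle (𝓡 n) M) = ⟨x', v'⟩) : b x u v = b x' u' v' := by
  obtain rfl : x = x' := congrArg TotalSpace.proj hu
  rw [eq_of_heq (TotalSpace.mk.inj hu).2, eq_of_heq (TotalSpace.mk.inj hv).2]

variable [IsManifold (𝓡 n) ∞ M]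

/-- The value of a field of bilinear forms in terms of its coordinate expression. -/
theorem BilinField.inChart_mfderiv (b : BilinField n M) {x₀ x : M}
    (hx : x ∈ (extChartAt (𝓡 n) x₀).source) (u v : TangentSpace (𝓡 n) x) :
    b.inChart x₀ (extChartAt (𝓡 n) x₀ x) (mfderiv (𝓡 n) 𝓘(ℝ, 𝔼) (extChartAt (𝓡 n) x₀) x u)
      (mfderiv (𝓡 n) 𝓘(ℝ, 𝔼) (extChartAt (𝓡 n) x₀) x v) = b x u v := by
  have h : ∀ u : TangentSpace (𝓡 n) x, tangentMap 𝓘(ℝ, 𝔼) (𝓡 n) (extChartAt (𝓡 n) x₀).symm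
      (tangentMap (𝓡 n) 𝓘(ℝ, 𝔼) (extChartAt (𝓡 n) x₀) (⟨x, u⟩ : TangentBundle (𝓡 n) M))
      = ⟨x, u⟩ := by
    intro u
    refine tangentMap_tangentMap_of_leftInverse (mdifferentiableAt_extChartAt_of_mem hx)
      (mdifferentiableAt_extChartAt_symm ((extChartAt (𝓡 n) x₀).map_source hx)) ?_
    filter_upwards [(isOpen_extChartAt_source x₀).mem_nhds hx] with z hz
      using (extChartAt (𝓡 n) x₀).left_inv hz
  exact b.apply_eq_of_mk_eq (h u) (h v)

theorem contDiffAt_chartChange {x₀ x₁ : M} {y : 𝔼} (hy : y ∈ (extChartAt (𝓡 n) x₀).target)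
    (hx : (extChartAt (𝓡 n) x₀).symm y ∈ (extChartAt (𝓡 n) x₁).source) :
    ContDiffAt ℝ ∞ (fun z ↦ extChartAt (𝓡 n) x₁ ((extChartAt (𝓡 n) x₀).symm z)) y := by
  have h1 := contMDiffAt_extChartAt_symm hy
  have h2 : ContMDiffAt (𝓡 n) 𝓘(ℝ, 𝔼) ∞ (extChartAt (𝓡 n) x₁)
      ((extChartAt (𝓡 n) x₀).symm y) :=
    contMDiffAt_extChartAt' (by rwa [extChartAt_source] at hx)
  exact (h2.comp y h1).contDiffAt

theorem eventually_mem_chartChange {x₀ x₁ : M} {y : 𝔼} (hy : y ∈ (extChartAt (𝓡 n) x₀).target)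
    (hx : (extChartAt (𝓡 n) x₀).symm y ∈ (extChartAt (𝓡 n) x₁).source) :
    ∀ᶠ z in 𝓝 y, z ∈ (extChartAt (𝓡 n) x₀).target ∧
      (extChartAt (𝓡 n) x₀).symm z ∈ (extChartAt (𝓡 n) x₁).source :=
  ((isOpen_extChartAt_target_euclidean x₀).eventually_mem hy).and
    ((contMDiffAt_extChartAt_symm hy).continuousAt.eventually
      ((isOpen_extChartAt_source x₁).eventually_mem hx))

/-- Two coordinate expressions of the same field are related by the change of charts. -/
theorem BilinField.inChart_eq_inChart (b : BilinField n M) {x₀ x₁ : M} {y : 𝔼}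
    (hy : y ∈ (extChartAt (𝓡 n) x₀).target)
    (hx : (extChartAt (𝓡 n) x₀).symm y ∈ (extChartAt (𝓡 n) x₁).source) (u v : 𝔼) :
    b.inChart x₀ y u v = b.inChart x₁ (extChartAt (𝓡 n) x₁ ((extChartAt (𝓡 n) x₀).symm y))
      (fderiv ℝ (fun z ↦ extChartAt (𝓡 n) x₁ ((extChartAt (𝓡 n) x₀).symm z)) y u)
      (fderiv ℝ (fun z ↦ extChartAt (𝓡 n) x₁ ((extChartAt (𝓡 n) x₀).symm z)) y v) := by
  set τ : 𝔼 → 𝔼 := fun z ↦ extChartAt (𝓡 n) x₁ ((extChartAt (𝓡 n) x₀).symm z) with hτ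
  have hτd : DifferentiableAt ℝ τ y := (contDiffAt_chartChange hy hx).differentiableAt (by simp)
  have hτy : τ y ∈ (extChartAt (𝓡 n) x₁).target := (extChartAt (𝓡 n) x₁).map_source hx
  have h : ∀ u : 𝔼, tangentMap 𝓘(ℝ, 𝔼) (𝓡 n) (extChartAt (𝓡 n) x₀).symm ⟨y, u⟩
      = tangentMap 𝓘(ℝ, 𝔼) (𝓡 n) (extChartAt (𝓡 n) x₁).symm ⟨τ y, fderiv ℝ τ y u⟩ := by
    intro u
    have e : (extChartAt (𝓡 n) x₀).symm =ᶠ[𝓝 y] (extChartAt (𝓡 n) x₁).symm ∘ τ := by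
      filter_upwards [eventually_mem_chartChange hy hx] with z hz
      exact ((extChartAt (𝓡 n) x₁).left_inv hz.2).symm
    have h2 := tangentMap_comp_at (I := 𝓘(ℝ, 𝔼)) (I' := 𝓘(ℝ, 𝔼)) (I'' := 𝓡 n) (f := τ)
      (g := (extChartAt (𝓡 n) x₁).symm) ⟨y, u⟩ (mdifferentiableAt_extChartAt_symm hτy)
      hτd.mdifferentiableAt
    have h3 : tangentMap 𝓘(ℝ, 𝔼) 𝓘(ℝ, 𝔼) τ ⟨y, u⟩ = ⟨τ y, fderiv ℝ τ y u⟩ := by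
      simp only [tangentMap, mfderiv_eq_fderiv]
      rfl
    rw [h3] at h2
    exact (tangentMap_congr (p := ⟨y, u⟩) e).trans h2
  exact b.apply_eq_of_mk_eq (h u) (h v)

/-- The curvature in two charts is related by the change of charts. -/
theorem MagneticSystem.fderiv_chartChange_connCurvature (S : MagneticSystem n M) {x₀ x₁ : M}
    {y : 𝔼} (hy : y ∈ (extChartAt (𝓡 n) x₀).target)
    (hx : (extChartAt (𝓡 n) x₀).symm y ∈ (extChartAt (𝓡 n) x₁).source) :
    Function.Injective
      (fderiv ℝ (fun z ↦ extChartAt (𝓡 n) x₁ ((extChartAt (𝓡 n) x₀).symm z)) y) ∧ ∀ a b c : 𝔼,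
    fderiv ℝ (fun z ↦ extChartAt (𝓡 n) x₁ ((extChartAt (𝓡 n) x₀).symm z)) y
      (connCurvature (leviCivita (BilinField.inChart S.metric.inner x₀)) y a b c)
    = connCurvature (leviCivita (BilinField.inChart S.metric.inner x₁))
      (extChartAt (𝓡 n) x₁ ((extChartAt (𝓡 n) x₀).symm y))
      (fderiv ℝ (fun z ↦ extChartAt (𝓡 n) x₁ ((extChartAt (𝓡 n) x₀).symm z)) y a)
      (fderiv ℝ (fun z ↦ extChartAt (𝓡 n) x₁ ((extChartAt (𝓡 n) x₀).symm z)) y b)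
      (fderiv ℝ (fun z ↦ extChartAt (𝓡 n) x₁ ((extChartAt (𝓡 n) x₀).symm z)) y c) := by
  have hG₀ := S.isMetricOn_inChart x₀
  have hG₁ := S.isMetricOn_inChart x₁
  set τ : 𝔼 → 𝔼 := fun z ↦ extChartAt (𝓡 n) x₁ ((extChartAt (𝓡 n) x₀).symm z) with hτ
  have hpull : ∀ z, z ∈ (extChartAt (𝓡 n) x₀).target ∧
      (extChartAt (𝓡 n) x₀).symm z ∈ (extChartAt (𝓡 n) x₁).source → ∀ a b,
      BilinField.inChart S.metric.inner x₀ z a b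
        = BilinField.inChart S.metric.inner x₁ (τ z) (fderiv ℝ τ z a) (fderiv ℝ τ z b) :=
    fun z hz a b ↦ BilinField.inChart_eq_inChart _ hz.1 hz.2 a b
  -- A linear isometry between positive definite forms is injective.
  have hinj : ∀ z, z ∈ (extChartAt (𝓡 n) x₀).target ∧
      (extChartAt (𝓡 n) x₀).symm z ∈ (extChartAt (𝓡 n) x₁).source →
      Function.Injective (fderiv ℝ τ z) := by
    intro z hz
    rw [injective_iff_map_eq_zero]
    intro a ha
    by_contra ha0
    have h1 := hG₀.pos z hz.1 a ha0
    rw [hpull z hz, ha, map_zero] at h1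
    exact lt_irrefl _ h1
  have hτy : τ y ∈ (extChartAt (𝓡 n) x₁).target := (extChartAt (𝓡 n) x₁).map_source hx
  refine ⟨hinj y ⟨hy, hx⟩, fderiv_connCurvature
    ((contDiffAt_chartChange hy hx).of_le ENat.LEInfty.out)
    (hG₁.differentiableAt_leviCivita hτy) (hG₀.differentiableAt_leviCivita hy) ?_⟩
  have hev := eventually_mem_chartChange hy hx
  filter_upwards [hev.eventually_nhds] with z hz a c
  have hz0 := hz.self_of_nhds
  refine fderiv_leviCivita hG₁ hG₀ hz0.1 ((extChartAt (𝓡 n) x₁).map_source hz0.2)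
    ((contDiffAt_chartChange hz0.1 hz0.2).of_le ENat.LEInfty.out)
    (LinearMap.injective_iff_surjective (f := (fderiv ℝ τ z : 𝔼 →ₗ[ℝ] 𝔼)).1 (hinj z hz0)) ?_ a c
  filter_upwards [hz] with w hw using hpull w hw

/-- The curvature of the definition of sectional curvature is that of the Levi-Civita
connection. -/
theorem MagneticSystem.curvatureInChart_eq (S : MagneticSystem n M) {x₀ : M} {y : 𝔼}
    (hy : y ∈ (extChartAt (𝓡 n) x₀).target) (u v w : 𝔼) :
    curvatureInChart S.metric.inner x₀ y u v w
      = connCurvature (leviCivita (BilinField.inChart S.metric.inner x₀)) y u v w := by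
  have hΓ := (S.isMetricOn_inChart x₀).differentiableAt_leviCivita hy
  simp only [curvatureInChart, christoffel_eq]
  rw [fderiv_clm_apply₂_const hΓ, fderiv_clm_apply₂_const hΓ, connCurvature_apply]

/-- The pointwise statement: if all `k`-planes are tangent to totally `s`-magnetic submanifolds,
there is no Lorentz force and the curvature is that of a space form. -/
theorem MagneticSystem.forceInChart_eq_zero_and {k : ℕ} (hk : 1 < k) (hkn : k < n)
    {S : MagneticSystem n M} {s : ℝ} (hs : 0 < s)
    (hplanes : ∀ (x : M) (W : Submodule ℝ (TangentSpace (𝓡 n) x)), Module.finrank ℝ W = k →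
      S.IsTangentToTotallyMagnetic s k x W) {x₀ : M} {y : 𝔼}
    (hy : y ∈ (extChartAt (𝓡 n) x₀).target) :
    (∀ u, S.forceInChart x₀ y u = 0) ∧ ∃ κ : ℝ, ∀ u v w,
      connCurvature (leviCivita (BilinField.inChart S.metric.inner x₀)) y u v w
        = κ • (BilinField.inChart S.metric.inner x₀ y v w • u
          - BilinField.inChart S.metric.inner x₀ y u w • v) := by
  have hG := S.isMetricOn_inChart x₀
  have hdim : k < Module.finrank ℝ 𝔼 := by simpa using hkn
  have hinv : ∀ W : Submodule ℝ 𝔼, Module.finrank ℝ W = k →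
      (∀ u ∈ W, S.forceInChart x₀ y u ∈ W) ∧ ∀ u ∈ W, ∀ v ∈ W, ∀ w ∈ W,
        connCurvature (leviCivita (BilinField.inChart S.metric.inner x₀)) y u v w ∈ W := by
    intro W hWk
    let A : 𝔼 →ₗ[ℝ] TangentSpace (𝓡 n) ((extChartAt (𝓡 n) x₀).symm y) :=
      (mfderiv 𝓘(ℝ, 𝔼) (𝓡 n) (extChartAt (𝓡 n) x₀).symm y).toLinearMap
    have hA : Function.Injective A := fun u v huv ↦
      (mfderiv_extChartAt_mfderiv_symm hy u).symm.trans
        ((congrArg (mfderiv (𝓡 n) 𝓘(ℝ, 𝔼) (extChartAt (𝓡 n) x₀) _) huv).trans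
          (mfderiv_extChartAt_mfderiv_symm hy v))
    refine MagneticSystem.mem_of_isTangentToTotallyMagnetic hs hy (W' := W.map A)
      (fun u ↦ ?_) (hplanes _ _ ?_)
    · exact ⟨fun h ↦ Submodule.mem_map_of_mem h, fun ⟨_, hu, he⟩ ↦ hA he ▸ hu⟩
    · rw [← hWk]
      exact (Submodule.equivMapOfInjective A hA W).finrank_eq.symm
  refine ⟨fun u ↦ eq_zero_of_forall_mem_of_skew hk.le hdim _ (hG.pos y hy) _ (fun v ↦ ?_)
    (fun W hW ↦ (hinv W hW).1) u, exists_eq_smul_of_forall_mem hk hdim (hG.symm y hy)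
    (hG.pos y hy) (connCurvature_swap _ y) (hG.connCurvature_skew hy)
    (hG.connCurvature_cyclic hy) fun W hW ↦ (hinv W hW).2⟩
  rw [S.inChart_forceInChart hy]
  exact S.form_self _ _

theorem exists_linearIndependent_pair (hn : 3 ≤ n) : ∃ a b : 𝔼, LinearIndependent ℝ ![a, b] := by
  obtain ⟨b, hb⟩ := exists_notMem_of_finrank_lt (P := (⊥ : Submodule ℝ 𝔼))
    (by rw [finrank_bot, finrank_euclideanSpace_fin]; omega)
  obtain ⟨a, ha⟩ := exists_notMem_of_finrank_lt (P := ℝ ∙ b)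
    ((finrank_span_singleton_le_one b).trans_lt (by rw [finrank_euclideanSpace_fin]; omega))
  exact ⟨a, b, linearIndependent_pair_of_notMem_span (fun h ↦ hb (by simp [h])) ha⟩

theorem IsMetricOn.smul_sub_smul_ne_zero {G : 𝔼 → 𝔼 →L[ℝ] 𝔼 →L[ℝ] ℝ} {U : Set 𝔼}
    (hG : IsMetricOn G U) {y : 𝔼} (hy : y ∈ U) {a b : 𝔼} (hab : LinearIndependent ℝ ![a, b]) :
    G y b b • a - G y a b • b ≠ 0 := by
  intro h0
  have h := LinearIndependent.pair_iff.1 hab (G y b b) (-G y a b)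
    (by rw [neg_smul]; simpa [sub_eq_add_neg] using h0)
  exact (hG.pos y hy b (hab.ne_zero 1)).ne' h.1

/-- In each chart, the pointwise constant sectional curvature is a differentiable function with
vanishing derivative. -/
theorem MagneticSystem.exists_curvature_function {k : ℕ} (hn : 3 ≤ n) (hk : 1 < k) (hkn : k < n)
    {S : MagneticSystem n M} {s : ℝ} (hs : 0 < s)
    (hplanes : ∀ (x : M) (W : Submodule ℝ (TangentSpace (𝓡 n) x)), Module.finrank ℝ W = k →
      S.IsTangentToTotallyMagnetic s k x W) (x₀ : M) :
    ∃ κ : 𝔼 → ℝ, (∀ y ∈ (extChartAt (𝓡 n) x₀).target, DifferentiableAt ℝ κ y ∧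
      fderiv ℝ κ y = 0 ∧ ∀ u v w,
      connCurvature (leviCivita (BilinField.inChart S.metric.inner x₀)) y u v w
        = κ y • (BilinField.inChart S.metric.inner x₀ y v w • u
          - BilinField.inChart S.metric.inner x₀ y u w • v)) := by
  have hG := S.isMetricOn_inChart x₀
  set G := BilinField.inChart S.metric.inner x₀ with hGdef
  obtain ⟨a, b, hab⟩ := exists_linearIndependent_pair hn
  -- `κ` is the sectional curvature of the fixed coordinate plane spanned by `a` and `b`.
  let κ : 𝔼 → ℝ := fun y ↦
    G y (connCurvature (leviCivita G) y a b b) a / (G y a a * G y b b - G y a b ^ 2)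
  have hgram : ∀ y ∈ (extChartAt (𝓡 n) x₀).target, G y a a * G y b b - G y a b ^ 2 ≠ 0 :=
    fun y hy ↦ gram_ne_zero (hG.symm y hy) (hG.pos y hy) hab
  have hκ : ∀ y ∈ (extChartAt (𝓡 n) x₀).target, ∀ u v w,
      connCurvature (leviCivita G) y u v w = κ y • (G y v w • u - G y u w • v) := by
    intro y hy
    obtain ⟨c, hc⟩ := (S.forceInChart_eq_zero_and hk hkn hs hplanes hy).2
    have hcκ : κ y = c := by
      simp only [κ]
      rw [hc, div_eq_iff (hgram y hy)]
      simp only [map_sub, map_smul, sub_apply, smul_apply, smul_eq_mul,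
        hG.symm y hy b a]
      ring
    rw [hcκ]
    exact hc
  have hd : ∀ y ∈ (extChartAt (𝓡 n) x₀).target, DifferentiableAt ℝ κ y := by
    intro y hy
    have h1 := hG.differentiableAt hy
    have h2 := hG.differentiableAt_leviCivita hy
    have h3 : DifferentiableAt ℝ (fderiv ℝ (leviCivita G)) y :=
      ((hG.contDiffAt_leviCivita hy).fderiv_right (m := ∞) (by simp)).differentiableAt (by simp)
    have hden : DifferentiableAt ℝ (fun z ↦ G z a a * G z b b - G z a b ^ 2) y := by fun_prop
    have hnum : DifferentiableAt ℝ
        (fun z ↦ G z (connCurvature (leviCivita G) z a b b) a) y := by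
      simp only [connCurvature_apply]
      fun_prop
    simpa only [κ, div_eq_mul_inv] using! hnum.fun_mul (hden.fun_inv (hgram y hy))
  refine ⟨κ, fun y hy ↦ ⟨hd y hy, ?_, hκ y hy⟩⟩
  refine hG.fderiv_eq_zero_of_connCurvature_eq ?_ hy (hd y hy) ?_
  · rw [finrank_euclideanSpace_fin]
    omega
  · filter_upwards [hG.isOpen.mem_nhds hy] with z hz using hκ z hz

end ConstantCurvature

theorem mainTheorem6 {n k : ℕ} (hn : 3 ≤ n) (hk : 1 < k) (hkn : k < n)
    {M : Type*} [TopologicalSpace M] [T2Space M] [SecondCountableTopology M] [ConnectedSpace M]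
    [ChartedSpace (EuclideanSpace ℝ (Fin n)) M] [IsManifold (𝓡 n) ∞ M]
    (S : MagneticSystem n M) (s : ℝ) (hs : 0 < s)
    (hplanes : ∀ (x : M) (W : Submodule ℝ (TangentSpace (𝓡 n) x)), Module.finrank ℝ W = k →
      S.IsTangentToTotallyMagnetic s k x W) :
    (∀ (x : M) (v w : TangentSpace (𝓡 n) x), S.form x v w = 0) ∧
      HasConstantSectionalCurvature S.metric.inner := by
  have hmem : ∀ x : M, extChartAt (𝓡 n) x x ∈ (extChartAt (𝓡 n) x).target := fun x ↦
    mem_extChartAt_target x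
  constructor
  · intro x v w
    have h0 : ∀ a b, S.form.inChart x (extChartAt (𝓡 n) x x) a b = 0 := fun a b ↦ by
      rw [← S.inChart_forceInChart (hmem x),
        (S.forceInChart_eq_zero_and hk hkn hs hplanes (hmem x)).1, map_zero, zero_apply]
    exact (BilinField.inChart_mfderiv S.form (mem_extChartAt_source x) v w).symm.trans (h0 _ _)
  choose κ hκ using S.exists_curvature_function hn hk hkn hs hplanes
  -- The curvature functions of two charts agree on the overlap.
  have hcompat : ∀ (x₀ x₁ x : M), x ∈ (extChartAt (𝓡 n) x₀).source →
      x ∈ (extChartAt (𝓡 n) x₁).source →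
      κ x₀ (extChartAt (𝓡 n) x₀ x) = κ x₁ (extChartAt (𝓡 n) x₁ x) := by
    intro x₀ x₁ x hx₀ hx₁
    have hy := (extChartAt (𝓡 n) x₀).map_source hx₀
    have hxx : (extChartAt (𝓡 n) x₀).symm (extChartAt (𝓡 n) x₀ x) = x :=
      (extChartAt (𝓡 n) x₀).left_inv hx₀
    have hx : (extChartAt (𝓡 n) x₀).symm (extChartAt (𝓡 n) x₀ x)
        ∈ (extChartAt (𝓡 n) x₁).source := by rwa [hxx]
    obtain ⟨hinj, hR⟩ := S.fderiv_chartChange_connCurvature hy hx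
    obtain ⟨a, b, hab⟩ := exists_linearIndependent_pair hn
    have h := hR a b b
    rw [(hκ x₀ _ hy).2.2, (hκ x₁ _ ((extChartAt (𝓡 n) x₁).map_source hx)).2.2,
      ← BilinField.inChart_eq_inChart _ hy hx, ← BilinField.inChart_eq_inChart _ hy hx,
      ← map_smul, ← map_smul, ← map_sub, ← map_smul, hxx] at h
    exact smul_left_injective ℝ
      ((S.isMetricOn_inChart x₀).smul_sub_smul_ne_zero hy hab) (hinj h)
  -- Near `x`, the value at `x'` may be computed in the chart at `x`, where `κ x` has vanishing
  -- derivative on a ball.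
  have hloc : IsLocallyConstant fun x : M ↦ κ x (extChartAt (𝓡 n) x x) := by
    rw [IsLocallyConstant.iff_eventually_eq]
    intro x
    have hopen := isOpen_extChartAt_target_euclidean (n := n) x
    obtain ⟨r, hr, hball⟩ := Metric.isOpen_iff.1 hopen _ (hmem x)
    have hcont : ContinuousAt (extChartAt (𝓡 n) x) x := continuousAt_extChartAt x
    filter_upwards [(isOpen_extChartAt_source x).mem_nhds (mem_extChartAt_source (I := 𝓡 n) x),
      hcont.eventually (Metric.ball_mem_nhds _ hr)] with x' hx' hx'r
    rw [hcompat x' x x' (mem_extChartAt_source x') hx']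
    exact Metric.isOpen_ball.is_const_of_fderiv_eq_zero (𝕜 := ℝ)
      (convex_ball _ _).isPreconnected
      (fun z hz ↦ (hκ x z (hball hz)).1.differentiableWithinAt)
      (fun z hz ↦ (hκ x z (hball hz)).2.1) hx'r (Metric.mem_ball_self hr)
  obtain ⟨p⟩ := (inferInstance : Nonempty M)
  refine ⟨κ p (extChartAt (𝓡 n) p p), fun x u v huv ↦ ?_⟩
  rw [hloc.apply_eq_of_preconnectedSpace p x]
  have hG := S.isMetricOn_inChart x
  have hgram := gram_ne_zero (E := EuclideanSpace ℝ (Fin n)) (g := S.metric.inner x)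
    (S.metric.symm x) (S.metric.pos x) huv
  have key : ∀ a b, BilinField.inChart S.metric.inner x (extChartAt (𝓡 n) x x)
      (curvatureInChart S.metric.inner x (extChartAt (𝓡 n) x x) a b b) a
      = κ x (extChartAt (𝓡 n) x x)
        * (BilinField.inChart S.metric.inner x (extChartAt (𝓡 n) x x) a a
          * BilinField.inChart S.metric.inner x (extChartAt (𝓡 n) x x) b b
          - BilinField.inChart S.metric.inner x (extChartAt (𝓡 n) x x) a b ^ 2) := by
    intro a b
    rw [S.curvatureInChart_eq (hmem x), (hκ x _ (hmem x)).2.2]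
    simp only [map_sub, map_smul, sub_apply, smul_apply, smul_eq_mul, hG.symm _ (hmem x) b a]
    ring
  have hA : ∀ a b, _ := BilinField.inChart_mfderiv S.metric.inner (mem_extChartAt_source x)
  exact (div_eq_iff hgram).2 ((key _ _).trans (congrArg (κ x (extChartAt (𝓡 n) x x) * ·)
    (congrArg₂ (· - ·) (congrArg₂ (· * ·) (hA u u) (hA v v)) (congrArg (· ^ 2) (hA u v)))))
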